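/- **Setup.** There are periods $t=1,\dots,\mathcal T$, a treated group ($D=1$) and an untreated group ($D=0$), and treatment takes place from period $t^*$ on, where $\mathcal T\ge 3$ and $3\le t^*\le\mathcal T$. $Y_t(1),Y_t(0)$ are the treated and untreated potential outcomes. The observed outcome is $Y_t=Y_t(0)$ for $t<t^*$ and $Y_t=D\,Y_t(1)+(1-D)Y_t(0)$ for $t\ge t^*$; before treatment, $Y_t(1)=Y_t(0)$ on $\{D=1\}$. $Z=(X,W)$ is a vector of $K=K_X+K_W$ time-invariant covariates (an intercept, if there is one, is one of them). $ATT_t=E[Y_t(1)-Y_t(0)\mid D=1]$. **Assumptions.** 1. (Model) $Y_t(0)=\xi+\lambda F_t+X'\beta_t+W'\alpha+U_t$ for $t=1,\dots,\mathcal T$, with unobserved random variables $\xi,\lambda,U_t$, constants $F_t,\beta_t,\alpha$ ($\alpha$ not depending on $t$), the normalizations $F_1=0$, $F_2=1$, $\beta_1=\beta_2=0$, and $U_t$ integrable with $E[U_t\mid\xi,\lambda,Z]=0$. 2. (Sampling) The observations $(Y_{i1},\dots,Y_{i\mathcal T},X_i,W_i,D_i)$, $i=1,\dots,n$, are iid copies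 of $(Y_1,\dots,Y_{\mathcal T},X,W,D)$. 3. (Selection) For all $t=1,\dots,\mathcal T$, $Y_t(0)$ is integrable and $E[Y_t(0)\mid\xi,\lambda,Z,D=1]=E[Y_t(0)\mid\xi,\lambda,Z,D=0]$. Let $q=(\mathcal T-2)+(t^*-3)$, $m=Kq$, $l=(\mathcal T-2)(K_X+1)$ and $a=K_X+\mathcal T+1$; blocks of size $t^*-3=0$ are empty. With $x'=(X',\,Y_2-Y_1)$ put $$\mathbf Z^0=\begin{pmatrix} I_{\mathcal T-2}\otimes(1-D)Z&0\\0&I_{t^*-3}\otimes DZ\end{pmatrix}\ (m\times q),\qquad \mathbf X^{0\prime}=\begin{pmatrix} I_{\mathcal T-2}\otimes x'\\ \big(I_{t^*-3}\otimes x',\ \mathbf 0\big)\end{pmatrix}\ (q\times l),$$ $$\mathbf Z=\begin{pmatrix}\mathbf Z^0&0\\0&I_a\end{pmatrix},\quad \mathbf X'=\begin{pmatrix}\mathbf X^{0\prime}&0\\0&I_a\end{pmatrix},\quad \mathbf Y=\big((Y_t-Y_1)_{t=3}^{\mathcal T},\,(Y_t-Y_1)_{t=3}^{t^*-1},\,DX',\,DY_1,\dots,DY_{\mathcal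 T},\,D\big)',$$ and let $\mathbf Z_i,\mathbf X_i',\mathbf Y_i$ be the same objects for observation $i$. The parameter vector is $$\gamma_1=(\beta_3',F_3,\dots,\beta_{\mathcal T}',F_{\mathcal T},E[DX'],E[DY_1],\dots,E[DY_{\mathcal T}],p)',\qquad p=P(D=1).$$ Put $\mathbf U=\mathbf Y-\mathbf X'\gamma_1$, $\mathbf M_{ZX}=E[\mathbf Z\mathbf X']$ and $\mathbf\Omega=E[\mathbf Z\mathbf U\mathbf U'\mathbf Z']$. 4. (Relevance) The entries of $\mathbf Z^0\mathbf X^{0\prime}$ are integrable and $E[\mathbf Z^0\mathbf X^{0\prime}]$ has full rank $l$. 5. $E\|\mathbf Y\|^4<\infty$, $E\|\mathbf Z\|^4<\infty$, and $\mathbf\Omega$ is positive definite. **Estimator.** Let $\hat{\mathbf M}_{ZX}=\frac1n\sum_{i=1}^n\mathbf Z_i\mathbf X_i'$ and $\hat{\mathbf M}_{ZY}=\frac1n\sum_{i=1}^n\mathbf Z_i\mathbf Y_i$, and for a weighting matrix $\mathbf W$ let $\hat\gamma(\mathbf W)=(\hat{\mathbf M}_{ZX}'\mathbf W\hat{\mathbf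 M}_{ZX})^{-1}\hat{\mathbf M}_{ZX}'\mathbf W\hat{\mathbf M}_{ZY}$. Let $\mathbf W_n$ be first-step weighting matrices (fixed or data dependent) that converge in probability to a positive definite matrix. With $\hat{\mathbf U}_i=\mathbf Y_i-\mathbf X_i'\hat\gamma(\mathbf W_n)$ and $\hat{\mathbf\Omega}=\frac1n\sum_{i=1}^n\mathbf Z_i\hat{\mathbf U}_i\hat{\mathbf U}_i'\mathbf Z_i'$, the two-step GMM estimator is $\hat\gamma_1=\hat\gamma(\hat{\mathbf\Omega}^{-1})$. For $t=3,\dots,\mathcal T$, let $g_t$ be the function of the parameter vector $$g_t(\gamma_1)=\frac{E[DY_t]-E[DY_1]}{p}-\frac{E[DX']}{p}\beta_t-F_t\,\frac{E[DY_2]-E[DY_1]}{p},\qquad \widehat{ATT}_t=g_t(\hat\gamma_1).$$ **Theorem.** Under these assumptions, $\mathbf M_{ZX}'\mathbf\Omega^{-1}\mathbf M_{ZX}$ is positive definite and, with $\mathbf\Sigma=(\mathbf M_{ZX}'\mathbf\Omega^{-1}\mathbf M_{ZX})^{-1}$, $$\sqrt n(\hat\gamma_1-\gamma_1)\xrightarrow{d}N(0,\mathbf\Sigma).$$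 For every $t=3,\dots,\mathcal T$: $Y_t(1)-Y_t(0)$ is integrable given $D=1$, $ATT_t=g_t(\gamma_1)$, and $g_t$ is differentiable at $\gamma_1$. The entries of its gradient $\nabla g_t(\gamma_1)$ are $-E[DX]/p$ (for $\beta_t$), $-(E[DY_2]-E[DY_1])/p$ (for $F_t$), $-\beta_t/p$ (for $E[DX]$), $-(1-F_t)/p$ (for $E[DY_1]$), $-F_t/p$ (for $E[DY_2]$), $1/p$ (for $E[DY_t]$), $-ATT_t/p$ (for $p$), and $0$ elsewhere. Moreover $$\sqrt n(\widehat{ATT}_t-ATT_t)=\nabla g_t(\gamma_1)'\sqrt n(\hat\gamma_1-\gamma_1)+o_p(1),\qquad \sqrt n(\widehat{ATT}_t-ATT_t)\xrightarrow{d}N(0,V_t),$$ where $V_t=\nabla g_t(\gamma_1)'\,\mathbf\Sigma\,\nabla g_t(\gamma_1)$. -/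

import Mathlib

open MeasureTheory ProbabilityTheory Filter Topology Matrix

noncomputable section

namespace IFE

/-! ### Index sets -/

/-- The periods `1, …, T`. -/
abbrev Per (T : ℕ) := ↥(Finset.Icc 1 T)

/-- The periods `3, …, T`. -/
abbrev Late (T : ℕ) := ↥(Finset.Icc 3 T)

/-- The periods `3, …, ts - 1` (empty if `ts = 3`), where treatment starts in period `ts`. -/
abbrev Pre (ts : ℕ) := ↥(Finset.Ico 3 ts)

/-- Index set of the covariates `Z = (X, W)`. -/
abbrev ZIdx (KX KW : ℕ) := Fin KX ⊕ Fin KW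

/-- Index set of the `KX + T + 1` auxiliary quantities `(D X, D Y_1, …, D Y_T, D)`. -/
abbrev AuxIdx (T KX : ℕ) := Fin KX ⊕ (Per T ⊕ Unit)

/-- Index set (size `q`) of the differenced outcomes: untreated group, then treated group. -/
abbrev QIdx (T ts : ℕ) := Late T ⊕ Pre ts

/-- Index set (size `m = K q`) of the moment conditions. -/
abbrev MIdx (T ts KX KW : ℕ) := (Late T × ZIdx KX KW) ⊕ (Pre ts × ZIdx KX KW)

/-- Index set (size `l = (T - 2) (KX + 1)`) of `(β_3, F_3, …, β_T, F_T)`. -/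
abbrev LIdx (T KX : ℕ) := Late T × (Fin KX ⊕ Unit)

/-- The augmented index sets, of sizes `q₁`, `m₁`, `l₁`. -/
abbrev QIdx1 (T ts KX : ℕ) := QIdx T ts ⊕ AuxIdx T KX
abbrev MIdx1 (T ts KX KW : ℕ) := MIdx T ts KX KW ⊕ AuxIdx T KX
abbrev LIdx1 (T KX : ℕ) := LIdx T KX ⊕ AuxIdx T KX

instance (T ts KX KW : ℕ) : DecidableEq (MIdx T ts KX KW) := instDecidableEqSum

instance (T ts KX KW : ℕ) : DecidableEq (MIdx1 T ts KX KW) := instDecidableEqSum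

/-! ### One observation `(Y_1, …, Y_T, X, W, D)` -/

/-- The data on one unit: outcomes in periods `1, …, T`, the covariates `X` and `W`, and the
treatment status (`true` for the treated group). -/
abbrev Obs (T KX KW : ℕ) := (Per T → ℝ) × (Fin KX → ℝ) × (Fin KW → ℝ) × Bool

variable {T KX KW : ℕ}

/-- `Y_t`; only used with `1 ≤ t ≤ T`. -/
def outY (o : Obs T KX KW) (t : ℕ) : ℝ := if h : t ∈ Finset.Icc 1 T then o.1 ⟨t, h⟩ else 0

def covX (o : Obs T KX KW) : Fin KX → ℝ := o.2.1

def covW (o : Obs T KX KW) : Fin KW → ℝ := o.2.2.1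

/-- `Z = (X, W)`. -/
def covZ (o : Obs T KX KW) : ZIdx KX KW → ℝ := Sum.elim (covX o) (covW o)

def treated (o : Obs T KX KW) : Bool := o.2.2.2

/-- The treatment indicator `D` as a real number. -/
def trtD (o : Obs T KX KW) : ℝ := if treated o = true then 1 else 0

/-! ### The bold matrices and vectors of one observation -/

/-- `((Y_t - Y_1)_{t = 3..T}, (Y_t - Y_1)_{t = 3..ts-1})`. -/
def vecY (ts : ℕ) (o : Obs T KX KW) : QIdx T ts → ℝ :=
  Sum.elim (fun t => outY o t - outY o 1) (fun t => outY o t - outY o 1)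

/-- `I ⊗ (1 - D) Z`. -/
def matZA (o : Obs T KX KW) : Matrix (Late T × ZIdx KX KW) (Late T) ℝ :=
  Matrix.of fun r s => if r.1 = s then (1 - trtD o) * covZ o r.2 else 0

/-- `I ⊗ D Z`. -/
def matZB (ts : ℕ) (o : Obs T KX KW) : Matrix (Pre ts × ZIdx KX KW) (Pre ts) ℝ :=
  Matrix.of fun r s => if r.1 = s then trtD o * covZ o r.2 else 0

/-- The `m × q` instrument matrix. -/
def matZ (ts : ℕ) (o : Obs T KX KW) : Matrix (MIdx T ts KX KW) (QIdx T ts) ℝ :=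
  Matrix.fromBlocks (matZA o) 0 0 (matZB ts o)

/-- The row vector `(X', Y_2 - Y_1)`. -/
def rowX (o : Obs T KX KW) : Fin KX ⊕ Unit → ℝ :=
  Sum.elim (covX o) (fun _ => outY o 2 - outY o 1)

/-- `I ⊗ (X', Y_2 - Y_1)`. -/
def matXA (o : Obs T KX KW) : Matrix (Late T) (LIdx T KX) ℝ :=
  Matrix.of fun s c => if s = c.1 then rowX o c.2 else 0

/-- `(I ⊗ (X', Y_2 - Y_1), 0)`: the columns of the periods `ts, …, T` vanish. -/
def matXB (ts : ℕ) (o : Obs T KX KW) : Matrix (Pre ts) (LIdx T KX) ℝ :=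
  Matrix.of fun s c => if (s : ℕ) = (c.1 : ℕ) then rowX o c.2 else 0

/-- The `q × l` regressor matrix (denoted `𝐗'` in bold). -/
def matX (ts : ℕ) (o : Obs T KX KW) : Matrix (QIdx T ts) (LIdx T KX) ℝ :=
  Matrix.fromRows (matXA o) (matXB ts o)

/-- `(D X, D Y_1, …, D Y_T, D)`. -/
def vecAux (o : Obs T KX KW) : AuxIdx T KX → ℝ :=
  Sum.elim (fun k => trtD o * covX o k)
    (Sum.elim (fun t => trtD o * outY o t) (fun _ => trtD o))

/-- The augmented outcome vector `𝐘_i`. -/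
def vecY1 (ts : ℕ) (o : Obs T KX KW) : QIdx1 T ts KX → ℝ := Sum.elim (vecY ts o) (vecAux o)

/-- The augmented instrument matrix `𝐙_i`. -/
def matZ1 (ts : ℕ) (o : Obs T KX KW) : Matrix (MIdx1 T ts KX KW) (QIdx1 T ts KX) ℝ :=
  Matrix.fromBlocks (matZ ts o) 0 0 1

/-- The augmented regressor matrix `𝐗_i'`. -/
def matX1 (ts : ℕ) (o : Obs T KX KW) : Matrix (QIdx1 T ts KX) (LIdx1 T KX) ℝ :=
  Matrix.fromBlocks (matX ts o) 0 0 1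

/-- The residual vector `𝐘_i - 𝐗_i' γ`. -/
def resid (ts : ℕ) (γ : LIdx1 T KX → ℝ) (o : Obs T KX KW) : QIdx1 T ts KX → ℝ :=
  vecY1 ts o - matX1 ts o *ᵥ γ

/-- `𝐙_i 𝐔_i 𝐔_i' 𝐙_i'` where `𝐔_i = 𝐘_i - 𝐗_i' γ`. -/
def momOuter (ts : ℕ) (γ : LIdx1 T KX → ℝ) (o : Obs T KX KW) :
    Matrix (MIdx1 T ts KX KW) (MIdx1 T ts KX KW) ℝ :=
  matZ1 ts o * Matrix.vecMulVec (resid ts γ o) (resid ts γ o) * (matZ1 ts o)ᵀ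

/-! ### Population quantities -/

section Population

variable {Ω : Type*} [MeasurableSpace Ω] (μ : Measure Ω) (O : Ω → Obs T KX KW)

/-- `E[𝐙𝐗']`, not augmented. -/
def popZX (ts : ℕ) : Matrix (MIdx T ts KX KW) (LIdx T KX) ℝ :=
  Matrix.of fun r c => ∫ ω, (matZ ts (O ω) * matX ts (O ω)) r c ∂μ

/-- `M_ZX = E[𝐙_i 𝐗_i']`, augmented. -/
def popM (ts : ℕ) : Matrix (MIdx1 T ts KX KW) (LIdx1 T KX) ℝ :=
  Matrix.of fun r c => ∫ ω, (matZ1 ts (O ω) * matX1 ts (O ω)) r c ∂μ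

/-- The parameter vector `γ₁ = (β_3', F_3, …, β_T', F_T, E[DX], E[DY_1], …, E[DY_T], p)`. -/
def popParam (β : ℕ → Fin KX → ℝ) (F : ℕ → ℝ) : LIdx1 T KX → ℝ :=
  Sum.elim (fun c => Sum.elim (β c.1) (fun _ => F c.1) c.2) (fun a => ∫ ω, vecAux (O ω) a ∂μ)

/-- `Ω = E[𝐙𝐔𝐔'𝐙']` with `𝐔_i = 𝐘_i - 𝐗_i' γ`. -/
def popOmega (ts : ℕ) (γ : LIdx1 T KX → ℝ) :
    Matrix (MIdx1 T ts KX KW) (MIdx1 T ts KX KW) ℝ :=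
  Matrix.of fun r c => ∫ ω, momOuter ts γ (O ω) r c ∂μ

/-- The event `D = d`. -/
def evD (d : Bool) : Set Ω := {ω | treated (O ω) = d}

/-- `ATT = E[Y(1) - Y(0) | D = 1]` for given potential outcomes of one period. -/
def popATT (Yone Yzero : Ω → ℝ) : ℝ :=
  ∫ ω, (Yone ω - Yzero ω) ∂(ProbabilityTheory.cond μ (evD O true))

/-- The conditioning variables `(ξ, λ, Z)`. -/
def condVars (ξ lam : Ω → ℝ) : Ω → ℝ × ℝ × (ZIdx KX KW → ℝ) :=
  fun ω => (ξ ω, lam ω, covZ (O ω))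

/-- The σ-algebra generated by `(ξ, λ, Z)`. -/
@[reducible] def condSigma (ξ lam : Ω → ℝ) : MeasurableSpace Ω :=
  MeasurableSpace.comap (condVars O ξ lam) inferInstance

/-- `E[V | ξ, λ, Z, D = 1] = E[V | ξ, λ, Z, D = 0]`: one and the same function of `(ξ, λ, Z)` is
a version of the conditional expectation of `V` given `(ξ, λ, Z)` under `P(· | D = d)`, for both
values of `d`. -/
def SameCondMean (ξ lam V : Ω → ℝ) : Prop :=
  ∃ h : ℝ × ℝ × (ZIdx KX KW → ℝ) → ℝ, Measurable h ∧ ∀ d : Bool,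
    MeasureTheory.condExp (condSigma O ξ lam) (ProbabilityTheory.cond μ (evD O d)) V
      =ᵐ[ProbabilityTheory.cond μ (evD O d)] fun ω => h (condVars O ξ lam ω)

end Population

/-! ### Estimators, as functions of the sample `s 0, …, s (n - 1)` -/

/-- `M̂_ZX`. -/
def hatM (ts n : ℕ) (s : ℕ → Obs T KX KW) : Matrix (MIdx1 T ts KX KW) (LIdx1 T KX) ℝ :=
  (n : ℝ)⁻¹ • ∑ i ∈ Finset.range n, matZ1 ts (s i) * matX1 ts (s i)

/-- `M̂_ZY`. -/
def hatMY (ts n : ℕ) (s : ℕ → Obs T KX KW) : MIdx1 T ts KX KW → ℝ :=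
  (n : ℝ)⁻¹ • ∑ i ∈ Finset.range n, matZ1 ts (s i) *ᵥ vecY1 ts (s i)

/-- The GMM estimator with weighting matrix `A`:
`(M̂_ZX' A M̂_ZX)⁻¹ M̂_ZX' A M̂_ZY`. -/
def gmm (ts n : ℕ) (A : Matrix (MIdx1 T ts KX KW) (MIdx1 T ts KX KW) ℝ)
    (s : ℕ → Obs T KX KW) : LIdx1 T KX → ℝ :=
  (((hatM ts n s)ᵀ * A * hatM ts n s)⁻¹ * (hatM ts n s)ᵀ * A) *ᵥ hatMY ts n s

/-- `Ω̂ = n⁻¹ ∑ 𝐙_i 𝐔̂_i 𝐔̂_i' 𝐙_i'` with residuals taken at `γ`. -/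
def hatOmega (ts n : ℕ) (γ : LIdx1 T KX → ℝ) (s : ℕ → Obs T KX KW) :
    Matrix (MIdx1 T ts KX KW) (MIdx1 T ts KX KW) ℝ :=
  (n : ℝ)⁻¹ • ∑ i ∈ Finset.range n, momOuter ts γ (s i)

/-- The two-step GMM estimator: the first step uses the weighting matrix `A`, the second step
the inverse of `Ω̂` formed from the first-step residuals. -/
def twoStep (ts n : ℕ) (A : Matrix (MIdx1 T ts KX KW) (MIdx1 T ts KX KW) ℝ)
    (s : ℕ → Obs T KX KW) : LIdx1 T KX → ℝ :=
  gmm ts n (hatOmega ts n (gmm ts n A s) s)⁻¹ s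

/-! ### The map `g_t` and its gradient -/

/-- The coordinate `E[D Y_s]` of a parameter vector; only used with `1 ≤ s ≤ T`. -/
def parDY (γ : LIdx1 T KX → ℝ) (s : ℕ) : ℝ :=
  if h : s ∈ Finset.Icc 1 T then γ (Sum.inr (Sum.inr (Sum.inl ⟨s, h⟩))) else 0

/-- The coordinate `E[D X_k]`. -/
def parDX (γ : LIdx1 T KX → ℝ) (k : Fin KX) : ℝ := γ (Sum.inr (Sum.inl k))

/-- The coordinate `p`. -/
def parP (γ : LIdx1 T KX → ℝ) : ℝ := γ (Sum.inr (Sum.inr (Sum.inr ())))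

/-- The coordinates `β_t`. -/
def parBeta (γ : LIdx1 T KX → ℝ) (t : Late T) (k : Fin KX) : ℝ := γ (Sum.inl (t, Sum.inl k))

/-- The coordinate `F_t`. -/
def parF (γ : LIdx1 T KX → ℝ) (t : Late T) : ℝ := γ (Sum.inl (t, Sum.inr ()))

/-- `g_t(γ) = (E[DY_t] - E[DY_1]) / p - (E[DX]' / p) β_t - F_t (E[DY_2] - E[DY_1]) / p`. -/
def gATT (t : Late T) (γ : LIdx1 T KX → ℝ) : ℝ :=
  (parDY γ t - parDY γ 1) / parP γ - (∑ k, parDX γ k / parP γ * parBeta γ t k)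
    - parF γ t * ((parDY γ 2 - parDY γ 1) / parP γ)

/-- The gradient of `g_t`: besides the entries below, all partial derivatives with respect to
`β_s`, `F_s` with `s ≠ t` and `E[DY_s]` with `s ∉ {1, 2, t}` vanish. -/
def gradATT (t : Late T) (γ : LIdx1 T KX → ℝ) : LIdx1 T KX → ℝ :=
  Sum.elim
    (fun c => if c.1 = t then
        Sum.elim (fun k => -(parDX γ k / parP γ))
          (fun _ => -((parDY γ 2 - parDY γ 1) / parP γ)) c.2
      else 0)
    (Sum.elim (fun k => -(parBeta γ t k / parP γ))
      (Sum.elim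
        (fun s => if (s : ℕ) = 1 then -((1 - parF γ t) / parP γ)
          else if (s : ℕ) = 2 then -(parF γ t / parP γ)
          else if (s : ℕ) = (t : ℕ) then 1 / parP γ
          else 0)
        (fun _ => -(gATT t γ / parP γ))))

end IFE

end

/-! Identification. Periods 1 and 2 precede treatment, so the normalizations give Y_1 = ξ + W'α +
U_1 and Y_2 - Y_1 = λ + U_2 - U_1. Solving for ξ + W'α and λ and substituting into the model for
period t leaves Y_t(0) - Y_1 = X'β_t + F_t (Y_2 - Y_1) + V_t, where V_t = U_t - U_1 - F_t (U_2 -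
U_1) is `quasiError`. The regressor Y_2 - Y_1 contains the errors of V_t, so Z serves as instrument.
The model makes U_t mean zero given (ξ, λ, Z) only on the whole population. Equality of the
conditional means of Y_t(0) across groups (`SameCondMean.setIntegral_eq`) carries this over to each
group separately, whence E[(1-D) Z V_t] = 0 for all t ≥ 3 and E[D Z V_t] = 0 for pre-treatment t
(`Model.mean_zero`). The remaining moments merely centre DX, DY_t and D. Averaging V_t over the
treated and replacing Y_t(0) by its representation yields ATT_t = g_t(γ₁) (`Model.popATT_eq`).

Estimation. After `Model.momentModel` the econometric model is forgotten: what remains is a linear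
moment condition E[h - G γ] = 0 on an iid sample, with E[G] of full column rank. On the event that
M̂'WM̂ is invertible, whose probability tends to one, γ̂ - γ is exactly a matrix converging in
probability times an average of mean-zero vectors (`gmmEst_sub`). Hence γ̂ is asymptotically linear
and √n-consistent for any convergent weighting with positive definite limit
(`MomentModel.tendsto_linearization`). This makes Ω̂ consistent (`MomentModel.tendsto_avgOuter`), so
the second step is the same statement with weight limit Ω⁻¹. The multivariate central limit theorem
and Slutsky's lemma give the normal limit, and the delta method transfers it to g_t.

Form of the argument. Convergence in probability is written as `Tendsto` along `probFilter`, so that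
limit algebra, continuous mapping and "with probability tending to one" are the ordinary calculus of
filters. `BddInProb` plays the role of O_p(1) through the rule O_p(1) · o_p(1) = o_p(1). Positive
definiteness of Ω also supplies square integrability of the moment functions (`memLp_moment`) and p
≠ 0 (`measure_treated_ne_zero`). -/

set_option linter.unusedSectionVars false

noncomputable section

namespace IFE

/-! ### Convergence in probability as convergence along a filter -/

section ProbFilter

variable {Ω' : Type*} [MeasurableSpace Ω']

/-- The sets of pairs `(n, ω)` whose `n`-th section has a complement of measure tending to zero.
Convergence in probability is convergence along this filter. -/
def probFilter (ν : Measure Ω') : Filter (ℕ × Ω') where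
  sets := {s | Tendsto (fun n => ν {ω | (n, ω) ∉ s}) atTop (𝓝 0)}
  univ_sets := by simp
  sets_of_superset := by
    intro s t hs hst
    refine tendsto_of_tendsto_of_tendsto_of_le_of_le tendsto_const_nhds hs (fun _ => zero_le)
      (fun n => measure_mono fun ω hω h => hω (hst h))
  inter_sets := by
    intro s t hs ht
    have h := Tendsto.add (Set.mem_ofPred_eq ▸ hs) (Set.mem_ofPred_eq ▸ ht)
    rw [add_zero] at h
    refine tendsto_of_tendsto_of_tendsto_of_le_of_le tendsto_const_nhds h (fun _ => zero_le)
      (fun n => (measure_mono ?_).trans (measure_union_le _ _))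
    intro ω hω
    by_contra hc
    simp only [Set.mem_union, Set.mem_ofPred_eq, not_or, not_not] at hc
    exact hω hc

variable {ν : Measure Ω'}

lemma mem_probFilter {s : Set (ℕ × Ω')} :
    s ∈ probFilter ν ↔ Tendsto (fun n => ν {ω | (n, ω) ∉ s}) atTop (𝓝 0) := Iff.rfl

/-- Both sides say, for each ε, that the measure of {ε ≤ edist (X n) c} tends to zero. This is the
bridge used to enter and leave the filter formulation. -/
lemma tendsto_probFilter_iff {E : Type*} [PseudoEMetricSpace E] {X : ℕ → Ω' → E} {c : E} :
    Tendsto (fun q : ℕ × Ω' => X q.1 q.2) (probFilter ν) (𝓝 c) ↔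
      TendstoInMeasure ν X atTop (fun _ => c) := by
  rw [Metric.nhds_basis_eball.tendsto_right_iff]
  refine forall_congr' fun ε => imp_congr_right fun _ => ?_
  rw [Filter.Eventually, mem_probFilter]
  simp

lemma tendsto_fst_probFilter : Tendsto Prod.fst (probFilter ν) atTop := by
  intro s hs
  rw [mem_map, mem_probFilter]
  refine tendsto_const_nhds.congr' ?_
  filter_upwards [hs] with n hn
  simp [hn]

lemma tendsto_probFilter_of_ae [IsFiniteMeasure ν] {E : Type*} [PseudoEMetricSpace E]
    {X : ℕ → Ω' → E} {c : E} (hX : ∀ n, AEStronglyMeasurable (X n) ν)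
    (h : ∀ᵐ ω ∂ν, Tendsto (fun n => X n ω) atTop (𝓝 c)) :
    Tendsto (fun q : ℕ × Ω' => X q.1 q.2) (probFilter ν) (𝓝 c) :=
  tendsto_probFilter_iff.2 (tendstoInMeasure_of_tendsto_ae hX h)

/-- Stochastic boundedness, expressed through products with sequences tending to zero in
probability. -/
def BddInProb (ν : Measure Ω') (X : ℕ × Ω' → ℝ) : Prop :=
  ∀ Y : ℕ × Ω' → ℝ, Tendsto Y (probFilter ν) (𝓝 0) →
    Tendsto (fun q => X q * Y q) (probFilter ν) (𝓝 0)

lemma BddInProb.of_tendsto {X : ℕ × Ω' → ℝ} {c : ℝ} (h : Tendsto X (probFilter ν) (𝓝 c)) :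
    BddInProb ν X := by
  intro Y hY
  simpa using h.mul hY

lemma BddInProb.add {X X' : ℕ × Ω' → ℝ} (h : BddInProb ν X) (h' : BddInProb ν X') :
    BddInProb ν (fun q => X q + X' q) := by
  intro Y hY
  simpa [add_mul] using (h Y hY).add (h' Y hY)

lemma BddInProb.mul {X X' : ℕ × Ω' → ℝ} (h : BddInProb ν X) (h' : BddInProb ν X') :
    BddInProb ν (fun q => X q * X' q) := by
  intro Y hY
  simpa [mul_assoc] using h _ (h' Y hY)

lemma BddInProb.sum {ι : Type*} (s : Finset ι) {X : ι → ℕ × Ω' → ℝ}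
    (h : ∀ i, BddInProb ν (X i)) : BddInProb ν (fun q => ∑ i ∈ s, X i q) := by
  intro Y hY
  simp_rw [Finset.sum_mul]
  simpa using tendsto_finsetSum s fun i _ => h i Y hY

lemma BddInProb.of_abs_le {X X' : ℕ × Ω' → ℝ} (h : BddInProb ν X) (hX : ∀ q, |X' q| ≤ |X q|) :
    BddInProb ν X' := by
  intro Y hY
  refine squeeze_zero_norm (a := fun q => ‖X q * Y q‖) (fun q => ?_) (by simpa using (h Y hY).norm)
  rw [norm_mul, norm_mul]
  exact mul_le_mul_of_nonneg_right (hX q) (norm_nonneg _)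

lemma BddInProb.abs {X : ℕ × Ω' → ℝ} (h : BddInProb ν X) : BddInProb ν (fun q => |X q|) :=
  h.of_abs_le fun q => by simp

/-- Off two small events |X n| < K and |Y| < ε / K, hence |X n * Y| < ε. The bound on the tails of X
must be uniform in n, while that on Y is only eventual. -/
lemma BddInProb.of_tight {X : ℕ → Ω' → ℝ}
    (h : ∀ ε : ENNReal, 0 < ε → ∃ K : ℝ, 0 < K ∧ ∀ n, ν {ω | K ≤ |X n ω|} ≤ ε) :
    BddInProb ν (fun q => X q.1 q.2) := by
  intro Y hY
  rw [Metric.tendsto_nhds] at hY ⊢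
  intro ε hε
  rw [Filter.Eventually, mem_probFilter]
  rw [ENNReal.tendsto_nhds_zero]
  intro η hη
  obtain ⟨K, hK, hKX⟩ := h (η / 2) (ENNReal.half_pos hη.ne')
  have h2 := hY (ε / K) (by positivity)
  rw [Filter.Eventually, mem_probFilter, ENNReal.tendsto_nhds_zero] at h2
  filter_upwards [h2 (η / 2) (ENNReal.half_pos hη.ne')] with n hn
  calc _ ≤ ν ({ω | K ≤ |X n ω|} ∪ {ω | (n, ω) ∉ {q | dist (Y q) 0 < ε / K}}) := by
        refine measure_mono fun ω hω => ?_
        by_contra hc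
        simp only [Set.mem_union, Set.mem_ofPred_eq, not_or, not_le, not_not, dist_zero_right,
          Real.norm_eq_abs] at hc hω
        apply hω
        rw [abs_mul]
        calc |X n ω| * |Y (n, ω)| ≤ K * |Y (n, ω)| := by gcongr; exact hc.1.le
          _ < K * (ε / K) := by gcongr; exact hc.2
          _ = ε := by field_simp
    _ ≤ η / 2 + η / 2 := (measure_union_le _ _).trans (add_le_add (hKX n) hn)
    _ = η := ENNReal.add_halves η

lemma BddInProb.of_variance_le [IsFiniteMeasure ν] {X : ℕ → Ω' → ℝ} (hX : ∀ n, MemLp (X n) 2 ν)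
    (h0 : ∀ n, ν[X n] = 0) {C : ℝ} (hC : ∀ n, Var[X n; ν] ≤ C) :
    BddInProb ν (fun q => X q.1 q.2) := by
  refine .of_tight fun ε hε => ?_
  obtain ⟨δ, hδ, hδε⟩ : ∃ δ : ℝ, 0 < δ ∧ ENNReal.ofReal δ ≤ ε := by
    rcases eq_or_ne ε ⊤ with rfl | h
    · exact ⟨1, one_pos, le_top⟩
    · exact ⟨ε.toReal, ENNReal.toReal_pos hε.ne' h, by rw [ENNReal.ofReal_toReal h]⟩
  have hC0 : 0 ≤ C := (variance_nonneg _ _).trans (hC 0)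
  -- Chebyshev with this threshold gives C δ / (C + 1) ≤ δ; adding 1 keeps the threshold positive
  -- when C = 0.
  refine ⟨√((C + 1) / δ), by positivity, fun n => ?_⟩
  have h := meas_ge_le_variance_div_sq (hX n) (c := √((C + 1) / δ)) (by positivity)
  rw [h0 n] at h
  simp only [sub_zero] at h
  refine h.trans (le_trans (ENNReal.ofReal_le_ofReal ?_) hδε)
  rw [Real.sq_sqrt (by positivity), div_div_eq_mul_div, div_le_iff₀ (by positivity)]
  nlinarith [hC n]

end ProbFilter

/-! ### Averages over an iid sample -/

section Sample

/-- Convergent averages force a n / n → 0. Thus all but finitely many of the first n terms are at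
most η n, and the sum of squares is at most a constant plus η n times the sum itself, which is of
order n. -/
lemma tendsto_sq_sum_div_sq {a : ℕ → ℝ} (ha : ∀ i, 0 ≤ a i) {c : ℝ}
    (h : Tendsto (fun n : ℕ => (n : ℝ)⁻¹ * ∑ i ∈ Finset.range n, a i) atTop (𝓝 c)) :
    Tendsto (fun n : ℕ => ((n : ℝ)⁻¹) ^ 2 * ∑ i ∈ Finset.range n, a i ^ 2) atTop (𝓝 0) := by
  have hinv : Tendsto (fun n : ℕ => (n : ℝ)⁻¹) atTop (𝓝 0) := tendsto_inv_atTop_nhds_zero_nat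
  have hlast : Tendsto (fun n : ℕ => (n : ℝ)⁻¹ * a n) atTop (𝓝 0) := by
    have h1 := (tendsto_add_atTop_iff_nat 1).2 h
    -- Here 1 + 1/n = (n+1)/n, so the expression is the difference of consecutive partial sums
    -- divided by n.
    have h2 : Tendsto (fun n : ℕ => (1 + (n : ℝ)⁻¹) * (((n + 1 : ℕ) : ℝ)⁻¹ *
        ∑ i ∈ Finset.range (n + 1), a i) - (n : ℝ)⁻¹ * ∑ i ∈ Finset.range n, a i) atTop
        (𝓝 0) := by
      have := ((hinv.const_add 1).mul h1).sub h
      simpa using this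
    refine h2.congr' ?_
    filter_upwards [eventually_gt_atTop 0] with n hn
    have hn' : (n : ℝ) ≠ 0 := by positivity
    have hn1 : (n : ℝ) + 1 ≠ 0 := by positivity
    rw [Finset.sum_range_succ]
    push_cast
    field_simp
    ring
  have hc : 0 ≤ c := ge_of_tendsto' h fun n =>
    mul_nonneg (by positivity) (Finset.sum_nonneg fun i _ => ha i)
  rw [Metric.tendsto_nhds]
  intro ε hε
  -- The averages are eventually below c + 1, so the tail contributes less than η (c + 1) = ε / 2;
  -- the other half of ε absorbs the first N terms.
  set η := ε / (2 * (c + 1)) with hη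
  have hη0 : 0 < η := by positivity
  obtain ⟨N, hN⟩ := eventually_atTop.1
    ((hlast.eventually (gt_mem_nhds hη0)).and (eventually_gt_atTop 0))
  have h1 : Tendsto (fun n : ℕ => ((n : ℝ)⁻¹) ^ 2 * ∑ i ∈ Finset.range N, a i ^ 2) atTop (𝓝 0) := by
    simpa using (hinv.pow 2).mul_const (∑ i ∈ Finset.range N, a i ^ 2)
  filter_upwards [h1.eventually (gt_mem_nhds (half_pos hε)),
    h.eventually (gt_mem_nhds (lt_add_one c)), eventually_gt_atTop 0] with n hn1 hn2 hn3
  have hn : (0 : ℝ) < n := by exact_mod_cast hn3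
  -- The induction runs over m with n fixed, so that the bound a m ≤ η m can be relaxed to the
  -- uniform η n.
  have key : ∀ m : ℕ, m ≤ n → ∑ i ∈ Finset.range m, a i ^ 2 ≤
      ∑ i ∈ Finset.range N, a i ^ 2 + η * n * ∑ i ∈ Finset.range m, a i := by
    intro m
    induction m with
    | zero => intro _; simpa using Finset.sum_nonneg fun i _ => sq_nonneg (a i)
    | succ m ih =>
      intro hm
      by_cases hmN : m < N
      · have : ∑ i ∈ Finset.range (m + 1), a i ^ 2 ≤ ∑ i ∈ Finset.range N, a i ^ 2 :=
          Finset.sum_le_sum_of_subset_of_nonneg (Finset.range_subset_range.2 hmN)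
            fun i _ _ => sq_nonneg _
        have h0 : 0 ≤ η * n * ∑ i ∈ Finset.range (m + 1), a i :=
          mul_nonneg (by positivity) (Finset.sum_nonneg fun i _ => ha i)
        linarith
      · obtain ⟨h3, h4⟩ := hN m (not_lt.1 hmN)
        have hm0 : (0 : ℝ) < m := by exact_mod_cast h4
        have h5 : a m ≤ η * n := by
          rw [inv_mul_lt_iff₀ hm0] at h3
          have : (m : ℝ) ≤ n := by exact_mod_cast (Nat.le_of_succ_le hm)
          nlinarith
        rw [Finset.sum_range_succ, Finset.sum_range_succ]
        have := ih (Nat.le_of_succ_le hm)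
        nlinarith [ha m]
  have hk := key n le_rfl
  have hpos : 0 ≤ ((n : ℝ)⁻¹) ^ 2 * ∑ i ∈ Finset.range n, a i ^ 2 :=
    mul_nonneg (by positivity) (Finset.sum_nonneg fun i _ => sq_nonneg _)
  rw [dist_zero_right, Real.norm_of_nonneg hpos]
  calc ((n : ℝ)⁻¹) ^ 2 * ∑ i ∈ Finset.range n, a i ^ 2
      ≤ ((n : ℝ)⁻¹) ^ 2 * (∑ i ∈ Finset.range N, a i ^ 2 + η * n * ∑ i ∈ Finset.range n, a i) := by
        gcongr
    _ = ((n : ℝ)⁻¹) ^ 2 * ∑ i ∈ Finset.range N, a i ^ 2 +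
        η * ((n : ℝ)⁻¹ * ∑ i ∈ Finset.range n, a i) := by field_simp
    _ < ε / 2 + η * (c + 1) := by gcongr
    _ = ε := by rw [hη]; field_simp; norm_num

variable {𝒪 : Type*} [MeasurableSpace 𝒪] {Ω : Type*} [MeasurableSpace Ω] {μ : Measure Ω}
  {O : Ω → 𝒪} {Ω' : Type*} [MeasurableSpace Ω'] {ν : Measure Ω'}
  {S : ℕ → Ω' → 𝒪}

lemma ae_tendsto_mean (hS : iIndepFun S ν) (hlaw : ∀ i, IdentDistrib (S i) O ν μ) {f : 𝒪 → ℝ}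
    (hf : Measurable f) (hfi : Integrable (fun ω => f (O ω)) μ) :
    ∀ᵐ ω ∂ν, Tendsto (fun n : ℕ => (n : ℝ)⁻¹ * ∑ i ∈ Finset.range n, f (S i ω)) atTop
      (𝓝 (∫ ω, f (O ω) ∂μ)) := by
  have h1 : ∀ i, IdentDistrib (fun ω => f (S i ω)) (fun ω => f (O ω)) ν μ :=
    fun i => (hlaw i).comp hf
  have h2 := strong_law_ae (μ := ν) (fun i ω => f (S i ω)) ((h1 0).integrable_iff.2 hfi)
    (fun i j hij => (hS.comp (fun _ => f) fun _ => hf).indepFun hij)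
    (fun i => (h1 i).trans (h1 0).symm)
  rw [(h1 0).integral_eq] at h2
  simpa using h2

lemma aemeasurable_sum_sample (hlaw : ∀ i, IdentDistrib (S i) O ν μ) {f : 𝒪 → ℝ}
    (hf : Measurable f) (n : ℕ) : AEMeasurable (fun ω => ∑ i ∈ Finset.range n, f (S i ω)) ν :=
  Finset.aemeasurable_fun_sum _ fun i _ => hf.comp_aemeasurable (hlaw i).aemeasurable_fst

lemma tendsto_mean [IsProbabilityMeasure ν] (hS : iIndepFun S ν)
    (hlaw : ∀ i, IdentDistrib (S i) O ν μ) {f : 𝒪 → ℝ}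
    (hf : Measurable f) (hfi : Integrable (fun ω => f (O ω)) μ) :
    Tendsto (fun q : ℕ × Ω' => (q.1 : ℝ)⁻¹ * ∑ i ∈ Finset.range q.1, f (S i q.2))
      (probFilter ν) (𝓝 (∫ ω, f (O ω) ∂μ)) :=
  tendsto_probFilter_of_ae
    (X := fun (n : ℕ) ω => (n : ℝ)⁻¹ * ∑ i ∈ Finset.range n, f (S i ω))
    (fun n => ((aemeasurable_sum_sample hlaw hf n).const_mul _).aestronglyMeasurable)
    (ae_tendsto_mean hS hlaw hf hfi)

/-- Here f is only integrable, so f² may have infinite mean and the law of large numbers is applied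
to |f| instead. -/
lemma ae_tendsto_sum_sq_div_sq (hS : iIndepFun S ν) (hlaw : ∀ i, IdentDistrib (S i) O ν μ)
    {f : 𝒪 → ℝ} (hf : Measurable f) (hfi : Integrable (fun ω => f (O ω)) μ) :
    ∀ᵐ ω ∂ν, Tendsto (fun n : ℕ => ((n : ℝ)⁻¹) ^ 2 * ∑ i ∈ Finset.range n, f (S i ω) ^ 2) atTop
      (𝓝 0) := by
  filter_upwards [ae_tendsto_mean hS hlaw hf.abs hfi.abs] with ω hω
  simpa using tendsto_sq_sum_div_sq (a := fun i => |f (S i ω)|) (fun i => abs_nonneg _) hω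

lemma tendsto_of_sq_tendsto_zero {α : Type*} {l : Filter α} {x : α → ℝ}
    (h : Tendsto (fun a => x a ^ 2) l (𝓝 0)) : Tendsto x l (𝓝 0) := by
  have := (Real.continuous_sqrt.tendsto 0).comp h
  simp only [Real.sqrt_zero] at this
  refine squeeze_zero_norm (fun a => ?_) this
  simp [Real.sqrt_sq_eq_abs]

/-- For integrable `f` and `g`, the average of `f g` is negligible compared to `n`. -/
lemma tendsto_cross_of_integrable [IsProbabilityMeasure ν] (hS : iIndepFun S ν)
    (hlaw : ∀ i, IdentDistrib (S i) O ν μ)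
    {f g : 𝒪 → ℝ} (hf : Measurable f) (hfi : Integrable (fun ω => f (O ω)) μ)
    (hg : Measurable g) (hgi : Integrable (fun ω => g (O ω)) μ) :
    Tendsto (fun q : ℕ × Ω' =>
      ((q.1 : ℝ)⁻¹) ^ 2 * ∑ i ∈ Finset.range q.1, f (S i q.2) * g (S i q.2))
      (probFilter ν) (𝓝 0) := by
  refine tendsto_probFilter_of_ae
    (X := fun (n : ℕ) ω => ((n : ℝ)⁻¹) ^ 2 * ∑ i ∈ Finset.range n, f (S i ω) * g (S i ω))
    (fun n => ((aemeasurable_sum_sample hlaw (hf.mul hg) n).const_mul _).aestronglyMeasurable) ?_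
  filter_upwards [ae_tendsto_sum_sq_div_sq hS hlaw hf hfi,
    ae_tendsto_sum_sq_div_sq hS hlaw hg hgi] with ω h1 h2
  refine tendsto_of_sq_tendsto_zero (squeeze_zero (fun n => by positivity) (fun n => ?_)
    (by simpa using h1.mul h2))
  -- Cauchy–Schwarz, with the factor n⁻⁴ shared equally between the two sums of squares.
  calc _ = ((n : ℝ)⁻¹) ^ 4 * (∑ i ∈ Finset.range n, f (S i ω) * g (S i ω)) ^ 2 := by ring
    _ ≤ ((n : ℝ)⁻¹) ^ 4 * ((∑ i ∈ Finset.range n, f (S i ω) ^ 2) *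
          ∑ i ∈ Finset.range n, g (S i ω) ^ 2) :=
        mul_le_mul_of_nonneg_left (Finset.sum_mul_sq_le_sq_mul_sq _ _ _) (by positivity)
    _ = _ := by ring

/-- For square integrable `f` and integrable `g`, the average of `f g` is negligible compared to
`√n`. -/
lemma tendsto_cross_of_sq_integrable [IsProbabilityMeasure ν] (hS : iIndepFun S ν)
    (hlaw : ∀ i, IdentDistrib (S i) O ν μ)
    {f g : 𝒪 → ℝ} (hf : Measurable f) (hfi : Integrable (fun ω => f (O ω) ^ 2) μ)
    (hg : Measurable g) (hgi : Integrable (fun ω => g (O ω)) μ) :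
    Tendsto (fun q : ℕ × Ω' =>
      (√(q.1 : ℝ))⁻¹ * ((q.1 : ℝ)⁻¹ * ∑ i ∈ Finset.range q.1, f (S i q.2) * g (S i q.2)))
      (probFilter ν) (𝓝 0) := by
  refine tendsto_probFilter_of_ae
    (X := fun (n : ℕ) ω =>
      (√(n : ℝ))⁻¹ * ((n : ℝ)⁻¹ * ∑ i ∈ Finset.range n, f (S i ω) * g (S i ω)))
    (fun n => (((aemeasurable_sum_sample hlaw (hf.mul hg) n).const_mul _).const_mul
      _).aestronglyMeasurable) ?_
  filter_upwards [ae_tendsto_mean hS hlaw (hf.pow_const 2) hfi,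
    ae_tendsto_sum_sq_div_sq hS hlaw hg hgi] with ω h1 h2
  refine tendsto_of_sq_tendsto_zero (squeeze_zero (fun n => by positivity) (fun n => ?_)
    (by simpa using h1.mul h2))
  have h3 : ((√(n : ℝ))⁻¹) ^ 2 = (n : ℝ)⁻¹ := by
    rw [inv_pow, Real.sq_sqrt (by positivity)]
  rw [mul_pow, h3, mul_pow]
  -- Cauchy–Schwarz again, with the factor n⁻³ split as n⁻¹ for the square integrable f and n⁻² for
  -- g.
  calc _ = ((n : ℝ)⁻¹ * ((n : ℝ)⁻¹) ^ 2) * (∑ i ∈ Finset.range n, f (S i ω) * g (S i ω)) ^ 2 := by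
        ring
    _ ≤ ((n : ℝ)⁻¹ * ((n : ℝ)⁻¹) ^ 2) * ((∑ i ∈ Finset.range n, f (S i ω) ^ 2) *
          ∑ i ∈ Finset.range n, g (S i ω) ^ 2) :=
        mul_le_mul_of_nonneg_left (Finset.sum_mul_sq_le_sq_mul_sq _ _ _) (by positivity)
    _ = _ := by ring

/-- Normalized sums of centred square integrable variables are stochastically bounded. -/
lemma bddInProb_normalized_sum [IsProbabilityMeasure ν] (hS : iIndepFun S ν)
    (hlaw : ∀ i, IdentDistrib (S i) O ν μ)
    {f : 𝒪 → ℝ} (hf : Measurable f) (hf2 : MemLp (fun ω => f (O ω)) 2 μ)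
    (hf0 : ∫ ω, f (O ω) ∂μ = 0) :
    BddInProb ν (fun q : ℕ × Ω' => (√(q.1 : ℝ))⁻¹ * ∑ i ∈ Finset.range q.1, f (S i q.2)) := by
  have h1 : ∀ i, IdentDistrib (fun ω => f (S i ω)) (fun ω => f (O ω)) ν μ :=
    fun i => (hlaw i).comp hf
  have hL : ∀ i, MemLp (fun ω => f (S i ω)) 2 ν := fun i => (h1 i).memLp_iff.2 hf2
  have hsum : ∀ n, MemLp (fun ω => ∑ i ∈ Finset.range n, f (S i ω)) 2 ν :=
    fun n => memLp_finsetSum _ fun i _ => hL i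
  refine .of_variance_le (X := fun (n : ℕ) ω => (√(n : ℝ))⁻¹ * ∑ i ∈ Finset.range n, f (S i ω))
    (fun n => (hsum n).const_mul _) (fun n => ?_) (C := Var[fun ω => f (O ω); μ]) (fun n => ?_)
  · rw [integral_const_mul, integral_finsetSum _ fun i _ => (hL i).integrable one_le_two]
    simp [(h1 _).integral_eq, hf0]
  · rw [variance_const_mul]
    have : (fun ω => ∑ i ∈ Finset.range n, f (S i ω)) =
        ∑ i ∈ Finset.range n, fun ω => f (S i ω) := by ext; simp
    rw [this, IndepFun.variance_sum (fun i _ => hL i)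
      (fun i _ j _ hij => (hS.comp (fun _ => f) fun _ => hf).indepFun hij)]
    simp only [(h1 _).variance_eq, Finset.sum_const, Finset.card_range, nsmul_eq_mul]
    rw [inv_pow, Real.sq_sqrt (by positivity), ← mul_assoc]
    rcases Nat.eq_zero_or_pos n with rfl | hn
    · simp [variance_nonneg]
    · rw [inv_mul_cancel₀ (by positivity), one_mul]

lemma aemeasurable_normalized_sum {κ : Type*} [Fintype κ]
    (hlaw : ∀ i, IdentDistrib (S i) O ν μ) {v : 𝒪 → κ → ℝ} (hv : Measurable v) (n : ℕ) :
    AEMeasurable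
      (fun ω => WithLp.toLp 2 ((√(n : ℝ))⁻¹ • ∑ i ∈ Finset.range n, v (S i ω))) ν := by
  have : AEMeasurable (fun ω => ∑ i ∈ Finset.range n, v (S i ω)) ν :=
    Finset.aemeasurable_fun_sum _ fun i _ => hv.comp_aemeasurable (hlaw i).aemeasurable_fst
  exact (WithLp.measurable_toLp 2 (κ → ℝ)).comp_aemeasurable (this.fun_const_smul _)

/-- The multivariate central limit theorem. -/
theorem tendstoInDistribution_multivariate {κ : Type*} [Fintype κ] [DecidableEq κ]
    [IsProbabilityMeasure ν] (hS : iIndepFun S ν) (hlaw : ∀ i, IdentDistrib (S i) O ν μ)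
    [IsProbabilityMeasure μ]
    {v : 𝒪 → κ → ℝ} (hv : Measurable v) (hv2 : ∀ c, MemLp (fun ω => v (O ω) c) 2 μ)
    (hv0 : ∀ c, ∫ ω, v (O ω) c ∂μ = 0) {Sig : Matrix κ κ ℝ} (hSig : Sig.PosSemidef)
    (hcov : ∀ c d, ∫ ω, v (O ω) c * v (O ω) d ∂μ = Sig c d) :
    TendstoInDistribution
      (fun (n : ℕ) ω => WithLp.toLp 2 ((√(n : ℝ))⁻¹ • ∑ i ∈ Finset.range n, v (S i ω))) atTop
      (id : EuclideanSpace ℝ κ → EuclideanSpace ℝ κ) (fun _ => ν) (multivariateGaussian 0 Sig) where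
  forall_aemeasurable n := aemeasurable_normalized_sum hlaw hv n
  aemeasurable_limit := aemeasurable_id
  tendsto := by
    have hmeas := aemeasurable_normalized_sum hlaw hv
    refine ProbabilityMeasure.tendsto_iff_tendsto_charFun.2 fun t => ?_
    -- Cramér–Wold: the characteristic function of the vector at t is that of the scalar projection
    -- along t at 1, so the one-dimensional central limit theorem suffices.
    let f : 𝒪 → ℝ := fun o => ∑ c, t c * v o c
    have hf : Measurable f := Finset.measurable_fun_sum _ fun c _ =>
      ((measurable_pi_iff.1 hv) c).const_mul _
    have hf2 : MemLp (fun ω => f (O ω)) 2 μ := memLp_finsetSum _ fun c _ => (hv2 c).const_mul _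
    have hf0 : ∫ ω, f (O ω) ∂μ = 0 := by
      simp only [f]
      rw [integral_finsetSum _ fun c _ => ((hv2 c).const_mul _).integrable one_le_two]
      simp [integral_const_mul, hv0]
    have hvar : Var[fun ω => f (O ω); μ] = t ⬝ᵥ Sig *ᵥ t := by
      rw [variance_of_integral_eq_zero hf2.1.aemeasurable hf0]
      have : ∀ ω, f (O ω) ^ 2 = ∑ c, ∑ d, t c * t d * (v (O ω) c * v (O ω) d) := by
        intro ω
        simp only [f, sq, Finset.sum_mul_sum]
        refine Finset.sum_congr rfl fun c _ => Finset.sum_congr rfl fun d _ => by ring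
      simp only [this]
      have hi : ∀ c d, Integrable (fun ω => t c * t d * (v (O ω) c * v (O ω) d)) μ :=
        fun c d => ((hv2 c).integrable_mul (hv2 d)).const_mul _
      rw [integral_finsetSum _ fun c _ => integrable_finsetSum _ fun d _ => hi c d]
      simp only [dotProduct, mulVec, Finset.mul_sum]
      refine Finset.sum_congr rfl fun c _ => ?_
      rw [integral_finsetSum _ fun d _ => hi c d]
      refine Finset.sum_congr rfl fun d _ => ?_
      rw [integral_const_mul, hcov]
      ring
    have h1 : ∀ i, IdentDistrib (fun ω => f (S i ω)) (fun ω => f (O ω)) ν μ :=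
      fun i => (hlaw i).comp hf
    have clt := tendstoInDistribution_inv_sqrt_mul_sum_sub (P := ν)
      (P' := gaussianReal 0 (Var[fun ω => f (S 0 ω); ν]).toNNReal) (Y := id)
      (X := fun i ω => f (S i ω)) ⟨aemeasurable_id, Measure.map_id⟩ ((h1 0).memLp_iff.2 hf2)
      (hS.comp (fun _ => f) fun _ => hf) (fun i => (h1 i).trans (h1 0).symm)
    have h2 := ProbabilityMeasure.tendsto_iff_tendsto_charFun.1 clt.tendsto 1
    simp only [ProbabilityMeasure.coe_mk, Measure.map_id, (h1 0).integral_eq, hf0,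
      (h1 0).variance_eq, hvar, mul_zero, sub_zero] at h2 ⊢
    have h3 : charFun (multivariateGaussian 0 Sig) t =
        charFun (gaussianReal 0 (t ⬝ᵥ Sig *ᵥ t).toNNReal) 1 := by
      have h0 : 0 ≤ t ⬝ᵥ Sig *ᵥ t := by simpa using hSig.dotProduct_mulVec_nonneg t
      rw [charFun_multivariateGaussian hSig, charFun_gaussianReal]
      simp [Real.coe_toNNReal _ h0]
    rw [h3]
    refine h2.congr fun n => ?_
    have hm2 : AEMeasurable (fun ω => (√(n : ℝ))⁻¹ * ∑ i ∈ Finset.range n, f (S i ω)) ν :=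
      (aemeasurable_sum_sample hlaw hf n).const_mul _
    rw [charFun_apply_real, charFun_apply, integral_map hm2 (by fun_prop),
      integral_map (hmeas n) (by fun_prop)]
    refine integral_congr_ae (ae_of_all _ fun ω => ?_)
    have : inner ℝ (WithLp.toLp 2 ((√(n : ℝ))⁻¹ • ∑ i ∈ Finset.range n, v (S i ω))) t =
        (√(n : ℝ))⁻¹ * ∑ i ∈ Finset.range n, f (S i ω) := by
      simp only [PiLp.inner_apply, f, Pi.smul_apply, Finset.sum_apply, smul_eq_mul,
        RCLike.inner_apply, conj_trivial]
      rw [Finset.sum_comm, Finset.mul_sum]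
      refine Finset.sum_congr rfl fun c _ => ?_
      rw [← Finset.mul_sum]
      ring
    simp only [this]
    simp

end Sample

/-! ### Linear GMM estimators -/

section GMM

variable {𝒪 ι κ : Type*} [Fintype ι] [Fintype κ] [DecidableEq ι] [DecidableEq κ]

/-- The matrix applied to the averaged outcome moments by the GMM estimator. -/
def gmmMap (W : Matrix ι ι ℝ) (M : Matrix ι κ ℝ) : Matrix κ ι ℝ := (Mᵀ * W * M)⁻¹ * Mᵀ * W

/-- The sample average of the matrices `G`. -/
def avgMat (G : 𝒪 → Matrix ι κ ℝ) (n : ℕ) (s : ℕ → 𝒪) : Matrix ι κ ℝ :=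
  (n : ℝ)⁻¹ • ∑ i ∈ Finset.range n, G (s i)

/-- The GMM estimator for the moment conditions `E[h - G γ] = 0` with weighting matrix `W`. -/
def gmmEst (G : 𝒪 → Matrix ι κ ℝ) (h : 𝒪 → ι → ℝ) (n : ℕ) (W : Matrix ι ι ℝ) (s : ℕ → 𝒪) :
    κ → ℝ :=
  gmmMap W (avgMat G n s) *ᵥ
    ((n : ℝ)⁻¹ • ∑ i ∈ Finset.range n, h (s i))

/-- The averaged outer product of the moment functions at `γ`. -/
def avgOuter (G : 𝒪 → Matrix ι κ ℝ) (h : 𝒪 → ι → ℝ) (n : ℕ) (γ : κ → ℝ) (s : ℕ → 𝒪) :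
    Matrix ι ι ℝ :=
  (n : ℝ)⁻¹ • ∑ i ∈ Finset.range n,
    vecMulVec (h (s i) - G (s i) *ᵥ γ) (h (s i) - G (s i) *ᵥ γ)

lemma gmmMap_mul {W : Matrix ι ι ℝ} {M : Matrix ι κ ℝ} (h : IsUnit (Mᵀ * W * M).det) :
    gmmMap W M * M = 1 := by
  rw [gmmMap, Matrix.mul_assoc, Matrix.mul_assoc, ← Matrix.mul_assoc Mᵀ, nonsing_inv_mul _ h]

/-- `gmmMap W M̂` is a left inverse of M̂, so subtracting γ amounts to subtracting M̂ γ from the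
averaged outcome moments. The identity is exact at every n for which the Gram matrix is invertible.
-/
lemma gmmEst_sub {G : 𝒪 → Matrix ι κ ℝ} {h : 𝒪 → ι → ℝ} {n : ℕ} {W : Matrix ι ι ℝ} {s : ℕ → 𝒪}
    (hu : IsUnit ((avgMat G n s)ᵀ * W *
      avgMat G n s).det) (γ : κ → ℝ) :
    gmmEst G h n W s - γ = gmmMap W (avgMat G n s) *ᵥ
      ((n : ℝ)⁻¹ • ∑ i ∈ Finset.range n, (h (s i) - G (s i) *ᵥ γ)) := by
  have : ∑ i ∈ Finset.range n, (G (s i) *ᵥ γ) = (∑ i ∈ Finset.range n, G (s i)) *ᵥ γ := by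
    rw [sum_mulVec]
  rw [Finset.sum_sub_distrib, smul_sub, mulVec_sub, this, ← smul_mulVec, mulVec_mulVec,
    ← avgMat, gmmMap_mul hu, one_mulVec, gmmEst]

lemma isUnit_det_gram {W : Matrix ι ι ℝ} (hW : W.PosDef) {M : Matrix ι κ ℝ}
    (hM : Function.Injective M.mulVec) : IsUnit (Mᵀ * W * M).det := by
  have := (hW.conjTranspose_mul_mul_same hM).isUnit
  rw [conjTranspose_eq_transpose_of_trivial] at this
  exact (isUnit_iff_isUnit_det _).1 this

lemma continuousAt_inv_of_isUnit {A : Matrix κ κ ℝ} (h : IsUnit A.det) :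
    ContinuousAt Inv.inv A :=
  continuousAt_matrix_inv A (by
    rw [Ring.inverse_eq_inv']
    exact continuousAt_inv₀ h.ne_zero)

/-- The efficient weighting matrix gives the variance `(M' Ω⁻¹ M)⁻¹`. -/
lemma gmmMap_mul_mul_transpose {Om : Matrix ι ι ℝ} (hOm : Om.PosDef) {M : Matrix ι κ ℝ}
    (hM : Function.Injective M.mulVec) :
    gmmMap Om⁻¹ M * Om * (gmmMap Om⁻¹ M)ᵀ = (Mᵀ * Om⁻¹ * M)⁻¹ := by
  have hu := isUnit_det_gram hOm.inv hM
  have hOu : IsUnit Om.det := (isUnit_iff_isUnit_det _).1 hOm.isUnit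
  have hsym : (Om⁻¹)ᵀ = Om⁻¹ := by
    simpa [conjTranspose_eq_transpose_of_trivial] using hOm.inv.1.eq
  have hsym2 : ((Mᵀ * Om⁻¹ * M)⁻¹)ᵀ = (Mᵀ * Om⁻¹ * M)⁻¹ := by
    rw [transpose_nonsing_inv]
    simp only [transpose_mul, transpose_transpose, hsym, Matrix.mul_assoc]
  have h1 : gmmMap Om⁻¹ M * Om = (Mᵀ * Om⁻¹ * M)⁻¹ * Mᵀ := by
    rw [gmmMap, Matrix.mul_assoc, nonsing_inv_mul _ hOu, Matrix.mul_one]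
  have h2 : (gmmMap Om⁻¹ M)ᵀ = Om⁻¹ * M * (Mᵀ * Om⁻¹ * M)⁻¹ := by
    rw [gmmMap, transpose_mul, transpose_mul, hsym, hsym2, transpose_transpose,
      ← Matrix.mul_assoc]
  rw [h1, h2, Matrix.mul_assoc, ← Matrix.mul_assoc Mᵀ, ← Matrix.mul_assoc Mᵀ,
    mul_nonsing_inv _ hu, Matrix.mul_one]

lemma tendsto_matrix_of_entries {α ι₁ ι₂ : Type*} {l : Filter α} {A : α → Matrix ι₁ ι₂ ℝ}
    {a : Matrix ι₁ ι₂ ℝ} (h : ∀ r c, Tendsto (fun x => A x r c) l (𝓝 (a r c))) :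
    Tendsto A l (𝓝 a) :=
  tendsto_pi_nhds.2 fun r => tendsto_pi_nhds.2 fun c => h r c

lemma tendsto_matrix_mul {α ι₁ ι₂ ι₃ : Type*} [Fintype ι₂] {l : Filter α}
    {A : α → Matrix ι₁ ι₂ ℝ} {B : α → Matrix ι₂ ι₃ ℝ} {a : Matrix ι₁ ι₂ ℝ} {b : Matrix ι₂ ι₃ ℝ}
    (hA : Tendsto A l (𝓝 a)) (hB : Tendsto B l (𝓝 b)) :
    Tendsto (fun x => A x * B x) l (𝓝 (a * b)) := by
  refine tendsto_pi_nhds.2 fun r => tendsto_pi_nhds.2 fun c => ?_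
  simp only [mul_apply]
  exact tendsto_finsetSum _ fun j _ => (tendsto_pi_nhds.1 (tendsto_pi_nhds.1 hA r) j).mul
    (tendsto_pi_nhds.1 (tendsto_pi_nhds.1 hB j) c)

lemma tendsto_matrix_transpose {α ι₁ ι₂ : Type*} {l : Filter α}
    {A : α → Matrix ι₁ ι₂ ℝ} {a : Matrix ι₁ ι₂ ℝ} (hA : Tendsto A l (𝓝 a)) :
    Tendsto (fun x => (A x)ᵀ) l (𝓝 aᵀ) :=
  tendsto_pi_nhds.2 fun r => tendsto_pi_nhds.2 fun c =>
    tendsto_pi_nhds.1 (tendsto_pi_nhds.1 hA c) r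

/-- Used to expand products of estimated residuals, with a and b the true moment functions and p, q
the corrections caused by estimating γ: a main term, two cross terms and a quadratic term. -/
lemma sum_sub_sum_mul_sub_sum (s : Finset ℕ) (a b : ℕ → ℝ) (p q : ℕ → κ → ℝ) :
    ∑ i ∈ s, (a i - ∑ c, p i c) * (b i - ∑ c, q i c) =
      ∑ i ∈ s, a i * b i - ∑ c, ∑ i ∈ s, a i * q i c - ∑ c, ∑ i ∈ s, b i * p i c +
        ∑ c, ∑ d, ∑ i ∈ s, p i c * q i d := by
  have h1 : ∑ c, ∑ i ∈ s, a i * q i c = ∑ i ∈ s, a i * ∑ c, q i c := by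
    rw [Finset.sum_comm]
    simp only [Finset.mul_sum]
  have h2 : ∑ c, ∑ i ∈ s, b i * p i c = ∑ i ∈ s, b i * ∑ c, p i c := by
    rw [Finset.sum_comm]
    simp only [Finset.mul_sum]
  have h3 : ∑ c, ∑ d, ∑ i ∈ s, p i c * q i d = ∑ i ∈ s, (∑ c, p i c) * ∑ d, q i d := by
    simp only [Finset.sum_mul_sum]
    rw [Finset.sum_comm (s := s)]
    exact Finset.sum_congr rfl fun c _ => Finset.sum_comm
  rw [h1, h2, h3, ← Finset.sum_sub_distrib, ← Finset.sum_sub_distrib, ← Finset.sum_add_distrib]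
  exact Finset.sum_congr rfl fun i _ => by ring

/-! ### Measurability of the estimators. -/

section Measurability

variable {Ω' : Type*} [MeasurableSpace Ω'] {ν : Measure Ω'} {ι₁ ι₂ ι₃ : Type*} [Fintype ι₂]

lemma aemeasurable_mul_entry {A : Ω' → Matrix ι₁ ι₂ ℝ} {B : Ω' → Matrix ι₂ ι₃ ℝ}
    (hA : ∀ r c, AEMeasurable (fun ω => A ω r c) ν)
    (hB : ∀ r c, AEMeasurable (fun ω => B ω r c) ν) (r : ι₁) (c : ι₃) :
    AEMeasurable (fun ω => (A ω * B ω) r c) ν := by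
  simp only [mul_apply]
  exact Finset.aemeasurable_fun_sum _ fun j _ => (hA r j).mul (hB j c)

lemma aemeasurable_mulVec_entry {A : Ω' → Matrix ι₁ ι₂ ℝ} {v : Ω' → ι₂ → ℝ}
    (hA : ∀ r c, AEMeasurable (fun ω => A ω r c) ν)
    (hv : ∀ r, AEMeasurable (fun ω => v ω r) ν) (r : ι₁) :
    AEMeasurable (fun ω => (A ω *ᵥ v ω) r) ν := by
  simp only [mulVec, dotProduct]
  exact Finset.aemeasurable_fun_sum _ fun j _ => (hA r j).mul (hv j)

/-- The inverse is the adjugate divided by the determinant. With 0⁻¹ = 0 this formula covers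
singular matrices too, which is needed because convergence in distribution asks for measurability at
every n. -/
lemma aemeasurable_inv_entry [DecidableEq ι₂] {A : Ω' → Matrix ι₂ ι₂ ℝ}
    (hA : ∀ r c, AEMeasurable (fun ω => A ω r c) ν) (r c : ι₂) :
    AEMeasurable (fun ω => (A ω)⁻¹ r c) ν := by
  have hA' : AEMeasurable (fun ω r c => A ω r c) ν :=
    aemeasurable_pi_iff.2 fun r => aemeasurable_pi_iff.2 fun c => hA r c
  have hof : Continuous fun B : ι₂ → ι₂ → ℝ => (Matrix.of B : Matrix ι₂ ι₂ ℝ) := continuous_id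
  have hdet : Measurable fun B : ι₂ → ι₂ → ℝ => (Matrix.of B).det := hof.matrix_det.measurable
  have hadj : Measurable fun B : ι₂ → ι₂ → ℝ => (Matrix.of B).adjugate r c :=
    (hof.matrix_adjugate.matrix_elem r c).measurable
  have h := (hdet.inv.mul hadj).comp_aemeasurable hA'
  refine h.congr (ae_of_all _ fun ω => ?_)
  simp only [Function.comp, Pi.mul_apply, Pi.inv_apply, inv_def, Ring.inverse_eq_inv',
    Matrix.smul_apply, smul_eq_mul]
  rfl

variable [MeasurableSpace 𝒪] {S : ℕ → Ω' → 𝒪} {G : 𝒪 → Matrix ι κ ℝ} {h : 𝒪 → ι → ℝ}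

lemma aemeasurable_avg_matrix (hS : ∀ i, AEMeasurable (S i) ν)
    (hG : ∀ r c, Measurable fun o => G o r c) (n : ℕ) (r : ι) (c : κ) :
    AEMeasurable (fun ω => avgMat G n (fun i => S i ω) r c) ν := by
  simp only [avgMat, Matrix.smul_apply, Matrix.sum_apply]
  exact (Finset.aemeasurable_fun_sum _ fun i _ =>
    (hG r c).comp_aemeasurable (hS i)).fun_const_smul _

lemma aemeasurable_gmmEst (hS : ∀ i, AEMeasurable (S i) ν)
    (hG : ∀ r c, Measurable fun o => G o r c) (hh : ∀ r, Measurable fun o => h o r) {n : ℕ}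
    {W : Ω' → Matrix ι ι ℝ} (hW : ∀ r c, AEMeasurable (fun ω => W ω r c) ν) (c : κ) :
    AEMeasurable (fun ω => gmmEst G h n (W ω) (fun i => S i ω) c) ν := by
  have hM := aemeasurable_avg_matrix (ν := ν) hS hG n
  have hMt : ∀ c r, AEMeasurable
    (fun ω => (avgMat G n (fun i => S i ω))ᵀ c r) ν := fun c r => hM r c
  refine aemeasurable_mulVec_entry ?_ (fun r => ?_) c
  · exact aemeasurable_mul_entry (aemeasurable_mul_entry (aemeasurable_inv_entry
      (aemeasurable_mul_entry (aemeasurable_mul_entry hMt hW) hM)) hMt) hW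
  · simp only [Pi.smul_apply, Finset.sum_apply]
    exact (Finset.aemeasurable_fun_sum _ fun i _ =>
      (hh r).comp_aemeasurable (hS i)).fun_const_smul _

lemma aemeasurable_avgOuter (hS : ∀ i, AEMeasurable (S i) ν)
    (hG : ∀ r c, Measurable fun o => G o r c) (hh : ∀ r, Measurable fun o => h o r) {n : ℕ}
    {γ : Ω' → κ → ℝ} (hγ : ∀ c, AEMeasurable (fun ω => γ ω c) ν) (r s : ι) :
    AEMeasurable (fun ω => avgOuter G h n (γ ω) (fun i => S i ω) r s) ν := by
  simp only [avgOuter, Matrix.smul_apply, Matrix.sum_apply]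
  refine (Finset.aemeasurable_fun_sum _ fun i _ => ?_).fun_const_smul _
  have he : ∀ r, AEMeasurable (fun ω => (h (S i ω) - G (S i ω) *ᵥ γ ω) r) ν := fun r =>
    ((hh r).comp_aemeasurable (hS i)).sub (aemeasurable_mulVec_entry
      (fun r c => (hG r c).comp_aemeasurable (hS i)) hγ r)
  exact (he r).mul (he s)

end Measurability

variable [MeasurableSpace 𝒪] {Ω : Type*} [MeasurableSpace Ω] {μ : Measure Ω}
  {O : Ω → 𝒪} {Ω' : Type*} [MeasurableSpace Ω'] {ν : Measure Ω'} [IsProbabilityMeasure ν]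
  {S : ℕ → Ω' → 𝒪} {G : 𝒪 → Matrix ι κ ℝ} {h : 𝒪 → ι → ℝ} {γ : κ → ℝ}
  {M : Matrix ι κ ℝ} {Om : Matrix ι ι ℝ}

/-- An iid sample satisfying the moment conditions `E[h - G γ] = 0`, where `G` has the mean `M` of
full column rank, and the moment functions have the second moments `Om`. -/
structure MomentModel (μ : Measure Ω) (O : Ω → 𝒪) (ν : Measure Ω') (S : ℕ → Ω' → 𝒪)
    (G : 𝒪 → Matrix ι κ ℝ) (h : 𝒪 → ι → ℝ) (γ : κ → ℝ) (M : Matrix ι κ ℝ)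
    (Om : Matrix ι ι ℝ) : Prop where
  indep : iIndepFun S ν
  law : ∀ i, IdentDistrib (S i) O ν μ
  measG : ∀ r c, Measurable fun o => G o r c
  measH : ∀ r, Measurable fun o => h o r
  intG : ∀ r c, Integrable (fun ω => G (O ω) r c) μ
  meanG : ∀ r c, ∫ ω, G (O ω) r c ∂μ = M r c
  memLp : ∀ r, MemLp (fun ω => (h (O ω) - G (O ω) *ᵥ γ) r) 2 μ
  mean_zero : ∀ r, ∫ ω, (h (O ω) - G (O ω) *ᵥ γ) r ∂μ = 0
  cov : ∀ r s, ∫ ω, (h (O ω) - G (O ω) *ᵥ γ) r * (h (O ω) - G (O ω) *ᵥ γ) s ∂μ = Om r s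
  injM : Function.Injective M.mulVec
  posOm : Om.PosDef

/-! ### Consistency and asymptotic linearity of GMM under the moment conditions. -/

namespace MomentModel

lemma measurable_moment (hm : ∀ r c, Measurable fun o => G o r c)
    (hh : ∀ r, Measurable fun o => h o r) (r : ι) :
    Measurable fun o => (h o - G o *ᵥ γ) r := by
  simp only [Pi.sub_apply, mulVec, dotProduct]
  exact (hh r).sub (Finset.measurable_fun_sum _ fun c _ => (hm r c).mul_const _)

lemma tendsto_avg (H : MomentModel μ O ν S G h γ M Om) :
    Tendsto (fun q : ℕ × Ω' => avgMat G q.1 (fun i => S i q.2)) (probFilter ν) (𝓝 M) := by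
  refine tendsto_pi_nhds.2 fun r => tendsto_pi_nhds.2 fun c => ?_
  simpa [avgMat, Matrix.sum_apply, H.meanG] using
    tendsto_mean H.indep H.law (H.measG r c) (H.intG r c)

lemma tendsto_gram (H : MomentModel μ O ν S G h γ M Om)
    {W : ℕ × Ω' → Matrix ι ι ℝ} {W₀ : Matrix ι ι ℝ}
    (hW : Tendsto W (probFilter ν) (𝓝 W₀)) :
    Tendsto (fun q : ℕ × Ω' => (avgMat G q.1 (fun i => S i q.2))ᵀ * W q *
      avgMat G q.1 (fun i => S i q.2)) (probFilter ν) (𝓝 (Mᵀ * W₀ * M)) := by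
  exact tendsto_matrix_mul (tendsto_matrix_mul (tendsto_matrix_transpose H.tendsto_avg) hW)
    H.tendsto_avg

/-- The limiting determinant is nonzero. "Eventually" along `probFilter` means with probability
tending to one. -/
lemma eventually_isUnit (H : MomentModel μ O ν S G h γ M Om)
    {W : ℕ × Ω' → Matrix ι ι ℝ} {W₀ : Matrix ι ι ℝ}
    (hW : Tendsto W (probFilter ν) (𝓝 W₀)) (hW₀ : W₀.PosDef) :
    ∀ᶠ q in probFilter ν, IsUnit ((avgMat G q.1 (fun i => S i q.2))ᵀ * W q *
      avgMat G q.1 (fun i => S i q.2)).det := by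
  have h1 := (continuous_id.matrix_det.tendsto _).comp (H.tendsto_gram hW)
  filter_upwards [h1.eventually_ne (isUnit_det_gram hW₀ H.injM).ne_zero] with q hq
  exact isUnit_iff_ne_zero.2 hq

lemma tendsto_gmmMap (H : MomentModel μ O ν S G h γ M Om)
    {W : ℕ × Ω' → Matrix ι ι ℝ} {W₀ : Matrix ι ι ℝ}
    (hW : Tendsto W (probFilter ν) (𝓝 W₀)) (hW₀ : W₀.PosDef) :
    Tendsto (fun q : ℕ × Ω' =>
      gmmMap (W q) (avgMat G q.1 (fun i => S i q.2))) (probFilter ν)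
      (𝓝 (gmmMap W₀ M)) := by
  have h1 := (continuousAt_inv_of_isUnit (isUnit_det_gram hW₀ H.injM)).tendsto.comp
    (H.tendsto_gram hW)
  exact tendsto_matrix_mul (tendsto_matrix_mul h1 (tendsto_matrix_transpose H.tendsto_avg)) hW

lemma bddInProb_moment (H : MomentModel μ O ν S G h γ M Om)
    (r : ι) : BddInProb ν (fun q : ℕ × Ω' => (√(q.1 : ℝ))⁻¹ *
    ∑ i ∈ Finset.range q.1, (h (S i q.2) - G (S i q.2) *ᵥ γ) r) :=
  bddInProb_normalized_sum (f := fun o => (h o - G o *ᵥ γ) r) H.indep H.law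
    (measurable_moment H.measG H.measH r) (H.memLp r)
    (H.mean_zero r)

/-- The asymptotically linear representation of the GMM estimator. -/
lemma tendsto_linearization (H : MomentModel μ O ν S G h γ M Om)
    {W : ℕ × Ω' → Matrix ι ι ℝ} {W₀ : Matrix ι ι ℝ}
    (hW : Tendsto W (probFilter ν) (𝓝 W₀)) (hW₀ : W₀.PosDef) (c : κ) :
    Tendsto (fun q : ℕ × Ω' => √(q.1 : ℝ) * (gmmEst G h q.1 (W q) (fun i => S i q.2) - γ) c -
      ∑ r, gmmMap W₀ M c r * ((√(q.1 : ℝ))⁻¹ *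
        ∑ i ∈ Finset.range q.1, (h (S i q.2) - G (S i q.2) *ᵥ γ) r)) (probFilter ν) (𝓝 0) := by
  have h1 := H.tendsto_gmmMap hW hW₀
  -- The remainder is, coordinate by coordinate, a stochastically bounded normalized sum times the
  -- vanishing error of the estimated GMM map.
  have h2 : Tendsto (fun q : ℕ × Ω' => ∑ r, ((√(q.1 : ℝ))⁻¹ *
        ∑ i ∈ Finset.range q.1, (h (S i q.2) - G (S i q.2) *ᵥ γ) r) *
      (gmmMap (W q) (avgMat G q.1 (fun i => S i q.2)) c r - gmmMap W₀ M c r))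
      (probFilter ν) (𝓝 0) := by
    have := tendsto_finsetSum (Finset.univ : Finset ι) fun r _ => H.bddInProb_moment r _
      (tendsto_sub_nhds_zero_iff.2 (tendsto_pi_nhds.1 (tendsto_pi_nhds.1 h1 c) r))
    simpa using this
  refine h2.congr' ?_
  filter_upwards [H.eventually_isUnit hW hW₀] with q hq
  rw [gmmEst_sub hq γ]
  simp only [mulVec, dotProduct]
  rw [Finset.mul_sum, ← Finset.sum_sub_distrib]
  refine Finset.sum_congr rfl fun r _ => ?_
  have hs : √(q.1 : ℝ) * (q.1 : ℝ)⁻¹ = (√(q.1 : ℝ))⁻¹ := by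
    rw [← div_eq_mul_inv, Real.sqrt_div_self', one_div]
  simp only [Pi.smul_apply, Finset.sum_apply, smul_eq_mul]
  rw [← hs]
  simp only [Pi.sub_apply, mulVec, dotProduct]
  ring

lemma bddInProb_gmmEst (H : MomentModel μ O ν S G h γ M Om)
    {W : ℕ × Ω' → Matrix ι ι ℝ} {W₀ : Matrix ι ι ℝ}
    (hW : Tendsto W (probFilter ν) (𝓝 W₀)) (hW₀ : W₀.PosDef) (c : κ) :
    BddInProb ν fun q : ℕ × Ω' =>
      √(q.1 : ℝ) * (gmmEst G h q.1 (W q) (fun i => S i q.2) - γ) c := by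
  have h1 := (BddInProb.of_tendsto (H.tendsto_linearization hW hW₀ c)).add
    (BddInProb.sum Finset.univ fun r => (BddInProb.of_tendsto
      (tendsto_const_nhds (x := gmmMap W₀ M c r))).mul (H.bddInProb_moment r))
  simpa using h1

/-- Consistency of the averaged outer product at a `√n`-consistent parameter estimate. -/
lemma tendsto_avgOuter (H : MomentModel μ O ν S G h γ M Om)
    {g : ℕ × Ω' → κ → ℝ}
    (hg : ∀ c, BddInProb ν fun q => √(q.1 : ℝ) * (g q - γ) c) :
    Tendsto (fun q : ℕ × Ω' => avgOuter G h q.1 (g q) (fun i => S i q.2)) (probFilter ν)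
      (𝓝 Om) := by
  refine tendsto_pi_nhds.2 fun r => tendsto_pi_nhds.2 fun s => ?_
  obtain ⟨e, he⟩ : ∃ e : 𝒪 → ι → ℝ, ∀ o, e o = h o - G o *ᵥ γ := ⟨_, fun _ => rfl⟩
  have hme : ∀ r, Measurable fun o => e o r := by
    simp only [he]
    exact measurable_moment H.measG H.measH
  have hL : ∀ r, MemLp (fun ω => e (O ω) r) 2 μ := by
    simp only [he]
    exact H.memLp
  have hcov : ∫ ω, e (O ω) r * e (O ω) s ∂μ = Om r s := by
    simp only [he]
    exact H.cov r s
  have h1 := tendsto_mean (f := fun o => e o r * e o s) H.indep H.law ((hme r).mul (hme s))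
    ((hL r).integrable_mul (hL s))
  -- Cross terms: √n (g - γ) is stochastically bounded, and the average of e · G is o_p(√n).
  have h2 : ∀ r s c, Tendsto (fun q : ℕ × Ω' => (√(q.1 : ℝ) * (g q - γ) c) *
      ((√(q.1 : ℝ))⁻¹ * ((q.1 : ℝ)⁻¹ * ∑ i ∈ Finset.range q.1, e (S i q.2) r * G (S i q.2) s c)))
      (probFilter ν) (𝓝 0) := fun r s c =>
    hg c _ (tendsto_cross_of_sq_integrable (f := fun o => e o r)
      (g := fun o => G o s c) H.indep H.law (hme r) (hL r).integrable_sq (H.measG s c) (H.intG s c))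
  -- Quadratic terms: two factors √n (g - γ) are bounded, and the sum of G · G is o_p(n²).
  -- Integrability of the entries of G is enough for this.
  have h3 : ∀ c d, Tendsto (fun q : ℕ × Ω' =>
      ((√(q.1 : ℝ) * (g q - γ) c) * (√(q.1 : ℝ) * (g q - γ) d)) *
      (((q.1 : ℝ)⁻¹) ^ 2 * ∑ i ∈ Finset.range q.1, G (S i q.2) r c * G (S i q.2) s d))
      (probFilter ν) (𝓝 0) := fun c d =>
    (hg c).mul (hg d) _ (tendsto_cross_of_integrable (f := fun o => G o r c)
      (g := fun o => G o s d) H.indep H.law (H.measG r c) (H.intG r c)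
      (H.measG s d) (H.intG s d))
  have h4 := ((h1.sub (tendsto_finsetSum Finset.univ fun c _ => h2 r s c)).sub
    (tendsto_finsetSum Finset.univ fun c _ => h2 s r c)).add
    (tendsto_finsetSum Finset.univ fun c _ => tendsto_finsetSum Finset.univ fun d _ => h3 c d)
  simp only [Finset.sum_const_zero, sub_zero, add_zero, hcov] at h4
  refine h4.congr' ?_
  filter_upwards [tendsto_fst_probFilter.eventually (eventually_gt_atTop 0)] with q hq
  have hn : (0 : ℝ) < q.1 := by exact_mod_cast hq
  have hsq : √(q.1 : ℝ) ≠ 0 := (Real.sqrt_pos.2 hn).ne'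
  have hss : √(q.1 : ℝ) * √(q.1 : ℝ) = q.1 := Real.mul_self_sqrt hn.le
  set δ := g q - γ with hδ
  have hres : ∀ i r, (h (S i q.2) - G (S i q.2) *ᵥ g q) r =
      e (S i q.2) r - ∑ c, G (S i q.2) r c * δ c := by
    intro i r
    have : g q = γ + δ := by simp [hδ]
    rw [this, mulVec_add]
    simp only [he, Pi.sub_apply, Pi.add_apply, mulVec, dotProduct]
    ring
  have t2 : ∀ r s c, (√(q.1 : ℝ) * δ c) *
      ((√(q.1 : ℝ))⁻¹ * ((q.1 : ℝ)⁻¹ * ∑ i ∈ Finset.range q.1, e (S i q.2) r * G (S i q.2) s c))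
      = (q.1 : ℝ)⁻¹ * ∑ i ∈ Finset.range q.1, e (S i q.2) r * (G (S i q.2) s c * δ c) := by
    intro r s c
    simp only [← mul_assoc (e _ _), ← Finset.sum_mul]
    field_simp
  have t3 : ∀ c d, ((√(q.1 : ℝ) * δ c) * (√(q.1 : ℝ) * δ d)) *
      (((q.1 : ℝ)⁻¹) ^ 2 * ∑ i ∈ Finset.range q.1, G (S i q.2) r c * G (S i q.2) s d)
      = (q.1 : ℝ)⁻¹ * ∑ i ∈ Finset.range q.1,
        (G (S i q.2) r c * δ c) * (G (S i q.2) s d * δ d) := by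
    intro c d
    have : ∀ i, (G (S i q.2) r c * δ c) * (G (S i q.2) s d * δ d) =
      (G (S i q.2) r c * G (S i q.2) s d) * (δ c * δ d) := fun i => by ring
    simp only [this, ← Finset.sum_mul]
    rw [show (√(q.1 : ℝ) * δ c) * (√(q.1 : ℝ) * δ d) = (√(q.1 : ℝ) * √(q.1 : ℝ)) * (δ c * δ d) by
      ring, hss]
    field_simp
  simp only [avgOuter, Matrix.smul_apply, Matrix.sum_apply, vecMulVec_apply, hres, smul_eq_mul,
    t2, t3, ← Finset.mul_sum]
  rw [← mul_sub, ← mul_sub, ← mul_add, ← sum_sub_sum_mul_sub_sum]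

end MomentModel

end GMM

/-! ### Two-step GMM and the delta method -/

section TwoStep

variable {𝒪 ι κ : Type*} [Fintype ι] [Fintype κ] [DecidableEq ι] [DecidableEq κ]
  [MeasurableSpace 𝒪] {Ω : Type*} [MeasurableSpace Ω] {μ : Measure Ω} [IsProbabilityMeasure μ]
  {O : Ω → 𝒪} {Ω' : Type*} [MeasurableSpace Ω'] {ν : Measure Ω'} [IsProbabilityMeasure ν]
  {S : ℕ → Ω' → 𝒪} {G : 𝒪 → Matrix ι κ ℝ} {h : 𝒪 → ι → ℝ} {γ : κ → ℝ}
  {M : Matrix ι κ ℝ} {Om : Matrix ι ι ℝ}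

/-- The two-step GMM estimator. -/
def twoStepEst (G : 𝒪 → Matrix ι κ ℝ) (h : 𝒪 → ι → ℝ) (n : ℕ) (W : Matrix ι ι ℝ) (s : ℕ → 𝒪) :
    κ → ℝ :=
  gmmEst G h n (avgOuter G h n (gmmEst G h n W s) s)⁻¹ s

namespace MomentModel

/-- The first-step estimator is √n-consistent, so Ω̂ is consistent, and inversion is continuous at
the invertible matrix Ω. Hence the second step is again GMM with a convergent weighting. -/
lemma tendsto_weight (H : MomentModel μ O ν S G h γ M Om) {A : ℕ → Ω' → Matrix ι ι ℝ}
    {A₀ : Matrix ι ι ℝ} (hA₀ : A₀.PosDef)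
    (hA : Tendsto (fun q : ℕ × Ω' => A q.1 q.2) (probFilter ν) (𝓝 A₀)) :
    Tendsto (fun q : ℕ × Ω' => (avgOuter G h q.1 (gmmEst G h q.1 (A q.1 q.2) fun i => S i q.2)
      fun i => S i q.2)⁻¹) (probFilter ν) (𝓝 Om⁻¹) :=
  (continuousAt_inv_of_isUnit ((isUnit_iff_isUnit_det _).1 H.posOm.isUnit)).tendsto.comp
    (H.tendsto_avgOuter (H.bddInProb_gmmEst hA hA₀))

lemma bddInProb_twoStepEst (H : MomentModel μ O ν S G h γ M Om) {A : ℕ → Ω' → Matrix ι ι ℝ}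
    {A₀ : Matrix ι ι ℝ} (hA₀ : A₀.PosDef)
    (hA : Tendsto (fun q : ℕ × Ω' => A q.1 q.2) (probFilter ν) (𝓝 A₀)) (c : κ) :
    BddInProb ν fun q : ℕ × Ω' =>
      √(q.1 : ℝ) * (twoStepEst G h q.1 (A q.1 q.2) (fun i => S i q.2) - γ) c :=
  H.bddInProb_gmmEst (H.tendsto_weight hA₀ hA) H.posOm.inv c

lemma aemeasurable_twoStepEst (H : MomentModel μ O ν S G h γ M Om) {A : ℕ → Ω' → Matrix ι ι ℝ}
    (hAm : ∀ n r c, AEMeasurable (fun ω => A n ω r c) ν) (n : ℕ) (c : κ) :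
    AEMeasurable (fun ω => twoStepEst G h n (A n ω) (fun i => S i ω) c) ν := by
  have hS : ∀ i, AEMeasurable (S i) ν := fun i => (H.law i).aemeasurable_fst
  exact aemeasurable_gmmEst hS H.measG H.measH (aemeasurable_inv_entry
    (aemeasurable_avgOuter hS H.measG H.measH (aemeasurable_gmmEst hS H.measG H.measH (hAm n)))) c

/-- Asymptotic normality of the two-step GMM estimator. -/
theorem tendstoInDistribution_twoStepEst (H : MomentModel μ O ν S G h γ M Om)
    {A : ℕ → Ω' → Matrix ι ι ℝ} {A₀ : Matrix ι ι ℝ} (hA₀ : A₀.PosDef)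
    (hAm : ∀ n r c, AEMeasurable (fun ω => A n ω r c) ν)
    (hA : Tendsto (fun q : ℕ × Ω' => A q.1 q.2) (probFilter ν) (𝓝 A₀)) :
    TendstoInDistribution
      (fun (n : ℕ) ω => WithLp.toLp 2
        (√(n : ℝ) • (twoStepEst G h n (A n ω) (fun i => S i ω) - γ))) atTop
      (id : EuclideanSpace ℝ κ → EuclideanSpace ℝ κ) (fun _ => ν)
      (multivariateGaussian 0 (Mᵀ * Om⁻¹ * M)⁻¹) := by
  set B := gmmMap Om⁻¹ M with hB
  obtain ⟨e, he⟩ : ∃ e : 𝒪 → ι → ℝ, ∀ o, e o = h o - G o *ᵥ γ := ⟨_, fun _ => rfl⟩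
  have hme : ∀ r, Measurable fun o => e o r := by
    simp only [he]
    exact measurable_moment H.measG H.measH
  have hL : ∀ r, MemLp (fun ω => e (O ω) r) 2 μ := by
    simp only [he]
    exact H.memLp
  have he0 : ∀ r, ∫ ω, e (O ω) r ∂μ = 0 := by
    simp only [he]
    exact H.mean_zero
  have hcov : ∀ r s, ∫ ω, e (O ω) r * e (O ω) s ∂μ = Om r s := by
    simp only [he]
    exact H.cov
  have hpos : (Mᵀ * Om⁻¹ * M)⁻¹.PosSemidef := by
    have := H.posOm.inv.conjTranspose_mul_mul_same H.injM
    rw [conjTranspose_eq_transpose_of_trivial] at this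
    exact this.inv.posSemidef
  have hBe : ∀ o c, (B *ᵥ e o) c = ∑ r, B c r * e o r := fun o c => rfl
  -- The central limit theorem is applied to the already linearized moments B e. Their covariance B
  -- Ω B' collapses to (M' Ω⁻¹ M)⁻¹ by `gmmMap_mul_mul_transpose`.
  have clt := tendstoInDistribution_multivariate (v := fun o => B *ᵥ e o) H.indep H.law
    (measurable_pi_iff.2 fun c => by
      simp only [hBe]
      exact Finset.measurable_fun_sum _ fun r _ => (hme r).const_mul _)
    (fun c => by
      simp only [hBe]
      exact memLp_finsetSum _ fun r _ => (hL r).const_mul _)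
    (fun c => by
      simp only [hBe]
      rw [integral_finsetSum _ fun r _ => ((hL r).integrable one_le_two).const_mul _]
      simp [integral_const_mul, he0]) hpos (fun c d => by
      have hexp : ∀ ω, (B *ᵥ e (O ω)) c * (B *ᵥ e (O ω)) d =
          ∑ r, ∑ s, B c r * B d s * (e (O ω) r * e (O ω) s) := by
        intro ω
        rw [hBe, hBe, Finset.sum_mul_sum]
        exact Finset.sum_congr rfl fun r _ => Finset.sum_congr rfl fun s _ => by ring
      have hi : ∀ r s, Integrable (fun ω => B c r * B d s * (e (O ω) r * e (O ω) s)) μ :=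
        fun r s => ((hL r).integrable_mul (hL s)).const_mul _
      simp only [hexp]
      rw [integral_finsetSum _ fun r _ => integrable_finsetSum _ fun s _ => hi r s,
        ← gmmMap_mul_mul_transpose H.posOm H.injM, ← hB]
      rw [Finset.sum_congr rfl fun r _ => integral_finsetSum _ fun s _ => hi r s]
      simp only [integral_const_mul, hcov, mul_apply, transpose_apply, Finset.sum_mul]
      rw [Finset.sum_comm]
      exact Finset.sum_congr rfl fun r _ => Finset.sum_congr rfl fun s _ => by ring)
  -- Slutsky: the estimator and its linearization differ by o_p(1).
  refine tendstoInDistribution_of_tendstoInMeasure_sub _ _ clt ?_ (fun n => ?_)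
  · refine tendsto_probFilter_iff.1 ?_
    have h1 := ((PiLp.continuous_toLp 2 (fun _ : κ => ℝ)).tendsto 0).comp
      (tendsto_pi_nhds.2 (H.tendsto_linearization (H.tendsto_weight hA₀ hA) H.posOm.inv))
    rw [WithLp.toLp_zero] at h1
    refine h1.congr fun q => ?_
    simp only [Function.comp, Pi.sub_apply, ← WithLp.toLp_sub]
    congr 1
    ext c
    simp only [Pi.sub_apply, Pi.smul_apply, Finset.sum_apply, smul_eq_mul, twoStepEst, hBe]
    congr 1
    rw [Finset.sum_comm, Finset.mul_sum]
    refine Finset.sum_congr rfl fun r _ => ?_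
    rw [← Finset.mul_sum]
    simp only [he, Pi.sub_apply, hB]
    ring
  · refine (WithLp.measurable_toLp 2 (κ → ℝ)).comp_aemeasurable (aemeasurable_pi_iff.2 fun c => ?_)
    exact ((H.aemeasurable_twoStepEst hAm n c).sub_const _).const_mul _

end MomentModel

lemma tendsto_of_bddInProb_sqrt {g : ℕ × Ω' → κ → ℝ}
    (hg : ∀ c, BddInProb ν fun q => √(q.1 : ℝ) * (g q - γ) c) :
    Tendsto (fun q => WithLp.toLp 2 (g q)) (probFilter ν) (𝓝 (WithLp.toLp 2 γ)) := by
  refine ((PiLp.continuous_toLp 2 (fun _ : κ => ℝ)).tendsto γ).comp (tendsto_pi_nhds.2 fun c => ?_)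
  rw [← tendsto_sub_nhds_zero_iff]
  have h1 : Tendsto (fun q : ℕ × Ω' => (√(q.1 : ℝ))⁻¹) (probFilter ν) (𝓝 0) :=
    (tendsto_inv_atTop_zero.comp (Real.tendsto_sqrt_atTop.comp
      tendsto_natCast_atTop_atTop)).comp tendsto_fst_probFilter
  refine (hg c _ h1).congr' ?_
  filter_upwards [tendsto_fst_probFilter.eventually (eventually_gt_atTop 0)] with q hq
  have hn : √(q.1 : ℝ) ≠ 0 := (Real.sqrt_pos.2 (by exact_mod_cast hq)).ne'
  rw [Pi.sub_apply]
  field_simp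

/-- The first-order expansion behind the delta method. -/
lemma tendsto_delta_remainder {g : ℕ × Ω' → κ → ℝ}
    (hg : ∀ c, BddInProb ν fun q => √(q.1 : ℝ) * (g q - γ) c)
    {f : EuclideanSpace ℝ κ → ℝ} {grad : κ → ℝ}
    (hf : HasGradientAt f (WithLp.toLp 2 grad) (WithLp.toLp 2 γ)) :
    Tendsto (fun q : ℕ × Ω' => √(q.1 : ℝ) * (f (WithLp.toLp 2 (g q)) - f (WithLp.toLp 2 γ)) -
      grad ⬝ᵥ (√(q.1 : ℝ) • (g q - γ))) (probFilter ν) (𝓝 0) := by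
  have hlo := hf.hasFDerivAt.isLittleO.norm_right
  -- Differentiability gives a remainder ρ(v) ‖v - γ‖ with ρ → 0 at γ. Scaled by √n and evaluated at
  -- the estimator it is O_p(1) · o_p(1).
  obtain ⟨ρ, hρ, hρe⟩ := hlo.exists_eq_mul
  have hc := tendsto_of_bddInProb_sqrt hg
  have hnorm : BddInProb ν fun q : ℕ × Ω' =>
      √(q.1 : ℝ) * ‖WithLp.toLp 2 (g q) - WithLp.toLp 2 γ‖ := by
    refine (BddInProb.sum Finset.univ fun c => (hg c).abs).of_abs_le fun q => ?_
    have h1 : ‖WithLp.toLp 2 (g q) - WithLp.toLp 2 γ‖ ≤ ∑ c, |(g q - γ) c| := by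
      rw [← WithLp.toLp_sub, EuclideanSpace.norm_eq]
      refine Real.sqrt_le_iff.2 ⟨Finset.sum_nonneg fun c _ => abs_nonneg _, ?_⟩
      simp only [Real.norm_eq_abs]
      exact Finset.sum_sq_le_sq_sum_of_nonneg fun c _ => abs_nonneg _
    rw [abs_of_nonneg (by positivity), abs_of_nonneg (Finset.sum_nonneg fun c _ => abs_nonneg _)]
    simp only [abs_mul, abs_of_nonneg (Real.sqrt_nonneg _), ← Finset.mul_sum]
    exact mul_le_mul_of_nonneg_left h1 (Real.sqrt_nonneg _)
  refine (hnorm _ (hρ.comp hc)).congr' ?_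
  filter_upwards [hc.eventually hρe] with q hq
  have hin : inner ℝ (WithLp.toLp 2 grad) (WithLp.toLp 2 (g q) - WithLp.toLp 2 γ) =
      grad ⬝ᵥ (g q - γ) := by
    rw [← WithLp.toLp_sub]
    simp [PiLp.inner_apply, dotProduct, mul_comm]
  simp only [Pi.mul_apply, InnerProductSpace.toDual_apply_apply, hin] at hq
  simp only [Function.comp]
  rw [dotProduct_smul, smul_eq_mul, ← mul_sub, hq]
  ring

/-- A continuous linear functional of a Gaussian vector is Gaussian, so only its mean and variance
have to be computed. -/
lemma map_dotProduct_multivariateGaussian {Sig : Matrix κ κ ℝ} (hSig : Sig.PosSemidef)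
    (a : κ → ℝ) :
    (multivariateGaussian 0 Sig).map (fun x : EuclideanSpace ℝ κ => a ⬝ᵥ x.ofLp) =
      gaussianReal 0 (a ⬝ᵥ Sig *ᵥ a).toNNReal := by
  have hfun : (fun x : EuclideanSpace ℝ κ => a ⬝ᵥ x.ofLp) =
      (innerSL ℝ (WithLp.toLp 2 a) : EuclideanSpace ℝ κ →L[ℝ] ℝ) := by
    ext x
    simp [PiLp.inner_apply, dotProduct, mul_comm]
  have hint : ∫ x, (innerSL ℝ (WithLp.toLp 2 a) : EuclideanSpace ℝ κ →L[ℝ] ℝ) x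
      ∂(multivariateGaussian 0 Sig) = 0 := by
    rw [ContinuousLinearMap.integral_comp_comm _ IsGaussian.integrable_fun_id]
    simp
  rw [hfun, IsGaussian.map_eq_gaussianReal, hint]
  have hv : Var[(innerSL ℝ (WithLp.toLp 2 a) : EuclideanSpace ℝ κ →L[ℝ] ℝ);
      multivariateGaussian 0 Sig] = a ⬝ᵥ Sig *ᵥ a := by
    have := covarianceBilin_multivariateGaussian (μ := 0) hSig (WithLp.toLp 2 a) (WithLp.toLp 2 a)
    rw [covarianceBilin_apply_eq_cov IsGaussian.memLp_two_id, covariance_self (by fun_prop)] at this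
    simpa using this
  rw [hv]

/-- The delta method. -/
theorem tendstoInDistribution_delta {g : ℕ → Ω' → κ → ℝ}
    {f : EuclideanSpace ℝ κ → ℝ} {grad : κ → ℝ} {Sig : Matrix κ κ ℝ} (hSig : Sig.PosSemidef)
    (hfm : ∀ n, AEMeasurable (fun ω => f (WithLp.toLp 2 (g n ω))) ν)
    (hg : TendstoInDistribution (fun (n : ℕ) ω => WithLp.toLp 2 (√(n : ℝ) • (g n ω - γ))) atTop
      (id : EuclideanSpace ℝ κ → EuclideanSpace ℝ κ) (fun _ => ν) (multivariateGaussian 0 Sig))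
    (hrem : Tendsto (fun q : ℕ × Ω' => √(q.1 : ℝ) *
        (f (WithLp.toLp 2 (g q.1 q.2)) - f (WithLp.toLp 2 γ)) -
      grad ⬝ᵥ (√(q.1 : ℝ) • (g q.1 q.2 - γ))) (probFilter ν) (𝓝 0)) :
    TendstoInDistribution
      (fun (n : ℕ) ω => √(n : ℝ) * (f (WithLp.toLp 2 (g n ω)) - f (WithLp.toLp 2 γ))) atTop
      (id : ℝ → ℝ) (fun _ => ν) (gaussianReal 0 (grad ⬝ᵥ Sig *ᵥ grad).toNNReal) := by
  have hcont : Continuous fun x : EuclideanSpace ℝ κ => grad ⬝ᵥ x.ofLp :=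
    continuous_const.dotProduct (PiLp.continuous_ofLp 2 _)
  have h1 := hg.continuous_comp hcont
  have h2 := tendstoInDistribution_of_tendstoInMeasure_sub
    (fun (n : ℕ) ω => √(n : ℝ) * (f (WithLp.toLp 2 (g n ω)) - f (WithLp.toLp 2 γ))) _ h1
    (tendsto_probFilter_iff.1 hrem) (fun n => ((hfm n).sub_const _).const_mul _)
  refine ⟨h2.forall_aemeasurable, aemeasurable_id, ?_⟩
  have h3 := h2.tendsto
  simp only [Function.comp_id] at h3
  convert h3 using 2
  refine congrArg 𝓝 (Subtype.ext ?_)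
  change Measure.map id _ = Measure.map _ _
  rw [Measure.map_id, map_dotProduct_multivariateGaussian hSig]

end TwoStep

/-! ### Consequences of the model and of the selection assumption -/

variable {T KX KW : ℕ}

lemma measurable_outY (t : ℕ) : Measurable fun o : Obs T KX KW => outY o t := by
  unfold outY
  split_ifs with h
  · exact (measurable_pi_apply _).comp measurable_fst
  · exact measurable_const

lemma measurable_covX : Measurable fun o : Obs T KX KW => covX o :=
  measurable_fst.comp measurable_snd

lemma measurable_covW : Measurable fun o : Obs T KX KW => covW o :=
  measurable_fst.comp (measurable_snd.comp measurable_snd)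

lemma measurable_covX_apply (k : Fin KX) : Measurable fun o : Obs T KX KW => covX o k :=
  (measurable_pi_apply k).comp measurable_covX

lemma measurable_covZ : Measurable fun o : Obs T KX KW => covZ o := by
  refine measurable_pi_iff.2 fun k => ?_
  rcases k with k | k
  · exact measurable_covX_apply k
  · exact (measurable_pi_apply k).comp measurable_covW

lemma measurable_treated : Measurable fun o : Obs T KX KW => treated o :=
  measurable_snd.comp (measurable_snd.comp measurable_snd)

lemma measurable_trtD : Measurable fun o : Obs T KX KW => trtD o :=
  Measurable.ite (measurable_treated (measurableSet_singleton true)) measurable_const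
    measurable_const

section Selection

variable {Ω : Type*} [m0 : MeasurableSpace Ω] {μ : Measure Ω} [IsProbabilityMeasure μ]
  {O : Ω → Obs T KX KW} {ξ lam : Ω → ℝ}

lemma measurableSet_evD (hO : Measurable O) (d : Bool) : MeasurableSet (evD O d) :=
  (measurable_treated.comp hO) (measurableSet_singleton d)

lemma condSigma_le (hO : Measurable O) (hξ : Measurable ξ) (hlam : Measurable lam) :
    condSigma O ξ lam ≤ m0 :=
  Measurable.comap_le (hξ.prodMk (hlam.prodMk (measurable_covZ.comp hO)))

lemma stronglyMeasurable_condVars {k : ℝ × ℝ × (ZIdx KX KW → ℝ) → ℝ} (hk : Measurable k) :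
    StronglyMeasurable[condSigma O ξ lam] fun ω => k (condVars O ξ lam ω) :=
  (hk.comp (comap_measurable (condVars O ξ lam))).stronglyMeasurable

/-- If `V` has the same conditional mean in both groups, then its conditional mean given the
conditioning variables also gives the integrals over each group. -/
lemma SameCondMean.setIntegral_eq (hO : Measurable O) (hξ : Measurable ξ) (hlam : Measurable lam)
    {V : Ω → ℝ} (hV : Integrable V μ) (hsel : SameCondMean μ O ξ lam V) {A : Set Ω}
    (hA : MeasurableSet[condSigma O ξ lam] A) (d : Bool) :
    ∫ ω in A ∩ evD O d, V ω ∂μ = ∫ ω in A ∩ evD O d, (μ[V | condSigma O ξ lam]) ω ∂μ := by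
  obtain ⟨h, hh, hcond⟩ := hsel
  have hm := condSigma_le hO hξ hlam
  have hE := measurableSet_evD hO
  have hA0 : MeasurableSet A := hm _ hA
  have hpos : ∀ d, μ (evD O d) ≠ 0 → (μ (evD O d))⁻¹ ≠ 0 ∧ (μ (evD O d))⁻¹ ≠ ⊤ := fun d hd =>
    ⟨ENNReal.inv_ne_zero.2 (measure_ne_top _ _), ENNReal.inv_ne_top.2 hd⟩
  -- A group may have probability zero here; its conditional measure is then the zero measure and
  -- all its integrals vanish. Otherwise conditioning is restriction up to a finite nonzero factor,
  -- which cancels.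
  have hVd : ∀ d, Integrable V (ProbabilityTheory.cond μ (evD O d)) := by
    intro d
    by_cases hd : μ (evD O d) = 0
    · rw [cond_eq_zero_of_meas_eq_zero hd]
      exact integrable_zero_measure
    · exact (hV.restrict (s := evD O d)).smul_measure (hpos d hd).2
  have hint : ∀ d, IntegrableOn (fun ω => h (condVars O ξ lam ω)) (evD O d) μ := by
    intro d
    by_cases hd : μ (evD O d) = 0
    · rw [IntegrableOn, Measure.restrict_eq_zero.2 hd]
      exact integrable_zero_measure
    · have h1 := (integrable_condExp (m := condSigma O ξ lam) (f := V)
        (μ := ProbabilityTheory.cond μ (evD O d))).congr (hcond d)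
      rwa [ProbabilityTheory.cond, integrable_smul_measure (hpos d hd).1 (hpos d hd).2] at h1
  have hset : ∀ B, MeasurableSet[condSigma O ξ lam] B → ∀ d,
      ∫ ω in B ∩ evD O d, V ω ∂μ = ∫ ω in B ∩ evD O d, h (condVars O ξ lam ω) ∂μ := by
    intro B hB d
    by_cases hd : μ (evD O d) = 0
    · rw [Measure.restrict_eq_zero.2 (measure_mono_null Set.inter_subset_right hd)]
      simp
    · have hprob : IsProbabilityMeasure (ProbabilityTheory.cond μ (evD O d)) :=
        cond_isProbabilityMeasure hd
      have h1 := setIntegral_condExp hm (hVd d) hB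
      rw [setIntegral_congr_ae (hm _ hB) ((hcond d).mono fun ω hω _ => hω)] at h1
      rw [ProbabilityTheory.cond, Measure.restrict_smul, integral_smul_measure,
        integral_smul_measure, Measure.restrict_restrict (hm _ hB)] at h1
      exact (mul_left_cancel₀ (ENNReal.toReal_ne_zero.2 (hpos d hd)) h1).symm
  have hcover : evD O true ∪ evD O false = Set.univ := by
    ext ω
    simp [evD]
  have hdisj : Disjoint (evD O true) (evD O false) := by
    rw [Set.disjoint_left]
    intro ω h1 h2
    simp only [evD, Set.mem_ofPred_eq] at h1 h2
    simp [h1] at h2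
  have hI : Integrable (fun ω => h (condVars O ξ lam ω)) μ := by
    rw [← integrableOn_univ, ← hcover]
    exact (hint true).union (hint false)
  have hsplit : ∀ B, MeasurableSet B → ∀ f : Ω → ℝ, Integrable f μ →
      ∫ ω in B, f ω ∂μ = ∫ ω in B ∩ evD O true, f ω ∂μ + ∫ ω in B ∩ evD O false, f ω ∂μ := by
    intro B hB f hf
    rw [← setIntegral_union (hdisj.mono Set.inter_subset_right Set.inter_subset_right)
      (hB.inter (hE false)) hf.integrableOn hf.integrableOn, ← Set.inter_union_distrib_left,
      hcover, Set.inter_univ]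
  -- Adding the two groups, h has the integrals of V over all sets of the σ-algebra, so h is also
  -- the conditional mean that does not condition on D. The common version h for both groups is what
  -- makes this work.
  have hae := ae_eq_condExp_of_forall_setIntegral_eq (μ := μ) hm hV
    (g := fun ω => h (condVars O ξ lam ω)) (fun B _ _ => hI.integrableOn)
    (fun B hB _ => by
      rw [hsplit B (hm _ hB) _ hI, hsplit B (hm _ hB) _ hV, hset B hB, hset B hB])
    (stronglyMeasurable_condVars hh).aestronglyMeasurable
  rw [hset A hA d]
  exact setIntegral_congr_ae (hA0.inter (hE d)) (hae.mono fun ω hω _ => hω)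

/-- Mean zero errors of the untreated outcomes remain mean zero within each group. -/
lemma SameCondMean.setIntegral_error (hO : Measurable O) (hξ : Measurable ξ)
    (hlam : Measurable lam) {V U : Ω → ℝ} (hV : Integrable V μ) (hUi : Integrable U μ)
    (hsel : SameCondMean μ O ξ lam V) (hU : μ[U | condSigma O ξ lam] =ᵐ[μ] 0)
    {k : ℝ × ℝ × (ZIdx KX KW → ℝ) → ℝ} (hk : Measurable k)
    (hVU : ∀ᵐ ω ∂μ, V ω = k (condVars O ξ lam ω) + U ω) {A : Set Ω}
    (hA : MeasurableSet[condSigma O ξ lam] A) (d : Bool) :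
    ∫ ω in A ∩ evD O d, U ω ∂μ = 0 := by
  have hm := condSigma_le hO hξ hlam
  have hki : Integrable (fun ω => k (condVars O ξ lam ω)) μ :=
    (hV.sub hUi).congr (hVU.mono fun ω hω => by simp [hω])
  -- Since U has conditional mean zero, k is the conditional mean of V; the integrals of V and k
  -- over the group therefore agree, and U is their difference.
  have h1 : μ[V | condSigma O ξ lam] =ᵐ[μ] fun ω => k (condVars O ξ lam ω) := by
    have h2 : V =ᵐ[μ] (fun ω => k (condVars O ξ lam ω)) + U := hVU
    refine (condExp_congr_ae h2).trans ((condExp_add hki hUi _).trans ?_)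
    rw [condExp_of_stronglyMeasurable hm (stronglyMeasurable_condVars hk) hki]
    filter_upwards [hU] with ω hω
    simp [hω]
  have hAE : MeasurableSet (A ∩ evD O d) := (hm _ hA).inter (measurableSet_evD hO d)
  have h3 := hsel.setIntegral_eq hO hξ hlam hV hA d
  rw [setIntegral_congr_ae hAE (h1.mono fun ω hω _ => hω),
    setIntegral_congr_ae hAE (hVU.mono fun ω hω _ => hω),
    integral_add hki.integrableOn hUi.integrableOn] at h3
  linarith

/-- Orthogonality of an error to functions of the conditioning variables within a group. -/
lemma integral_mul_indicator_eq_zero (hO : Measurable O) (hξ : Measurable ξ)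
    (hlam : Measurable lam) {R : Ω → ℝ} (hR : Integrable R μ) {d : Bool}
    (hR0 : ∀ A, MeasurableSet[condSigma O ξ lam] A → ∫ ω in A ∩ evD O d, R ω ∂μ = 0)
    {k : ℝ × ℝ × (ZIdx KX KW → ℝ) → ℝ} (hk : Measurable k)
    (hint : Integrable (fun ω => k (condVars O ξ lam ω) * (evD O d).indicator R ω) μ) :
    ∫ ω, k (condVars O ξ lam ω) * (evD O d).indicator R ω ∂μ = 0 := by
  have hm := condSigma_le hO hξ hlam
  have hE := measurableSet_evD hO d
  have hRi : Integrable ((evD O d).indicator R) μ := hR.indicator hE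
  -- The hypothesis `hR0` says that R · 1{D = d} has conditional mean zero; the factor k is then
  -- pulled out of the conditional expectation.
  have h0 : (0 : Ω → ℝ) =ᵐ[μ] μ[(evD O d).indicator R | condSigma O ξ lam] :=
    ae_eq_condExp_of_forall_setIntegral_eq hm hRi
      (fun _ _ _ => (integrable_zero _ _ _).integrableOn)
      (fun A hA _ => by rw [setIntegral_indicator hE, hR0 A hA]; simp)
      stronglyMeasurable_zero.aestronglyMeasurable
  have h1 := condExp_mul_of_stronglyMeasurable_left
    (stronglyMeasurable_condVars (O := O) (ξ := ξ) (lam := lam) hk) hint hRi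
  have h2 := integral_condExp (μ := μ) hm
    (f := (fun ω => k (condVars O ξ lam ω)) * (evD O d).indicator R)
  rw [integral_congr_ae h1] at h2
  have h3 : ∫ ω, ((fun ω => k (condVars O ξ lam ω)) *
      μ[(evD O d).indicator R | condSigma O ξ lam]) ω ∂μ = 0 := by
    refine integral_eq_zero_of_ae ?_
    filter_upwards [h0] with ω hω
    simp [← hω]
  rw [h3] at h2
  exact h2.symm

end Selection

/-! ### The moment functions of one observation -/

/-- The matrix `𝐙 𝐗'` of one observation. -/
def obsG (ts : ℕ) (o : Obs T KX KW) : Matrix (MIdx1 T ts KX KW) (LIdx1 T KX) ℝ :=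
  matZ1 ts o * matX1 ts o

/-- The vector `𝐙 𝐘` of one observation. -/
def obsH (ts : ℕ) (o : Obs T KX KW) : MIdx1 T ts KX KW → ℝ := matZ1 ts o *ᵥ vecY1 ts o

lemma obsH_sub (ts : ℕ) (γ : LIdx1 T KX → ℝ) (o : Obs T KX KW) :
    obsH ts o - obsG ts o *ᵥ γ = matZ1 ts o *ᵥ resid ts γ o := by
  rw [obsH, obsG, resid, mulVec_sub, mulVec_mulVec]

lemma momOuter_eq (ts : ℕ) (γ : LIdx1 T KX → ℝ) (o : Obs T KX KW) :
    momOuter ts γ o =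
      vecMulVec (obsH ts o - obsG ts o *ᵥ γ) (obsH ts o - obsG ts o *ᵥ γ) := by
  rw [obsH_sub, momOuter, mul_vecMulVec, vecMulVec_mul, vecMul_transpose]

lemma twoStep_eq (ts n : ℕ) (A : Matrix (MIdx1 T ts KX KW) (MIdx1 T ts KX KW) ℝ)
    (s : ℕ → Obs T KX KW) : twoStep ts n A s = twoStepEst (obsG ts) (obsH ts) n A s := by
  have h : ∀ γ, hatOmega ts n γ s = avgOuter (obsG ts) (obsH ts) n γ s := by
    intro γ
    simp only [hatOmega, avgOuter, momOuter_eq]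
  rw [twoStep, h]
  rfl

lemma obsG_eq (ts : ℕ) (o : Obs T KX KW) :
    obsG ts o = fromBlocks (matZ ts o * matX ts o) 0 0 1 := by
  simp [obsG, matZ1, matX1, fromBlocks_multiply]

lemma mulVec_matZ1_late (ts : ℕ) (o : Obs T KX KW) (v : QIdx1 T ts KX → ℝ) (t : Late T)
    (k : ZIdx KX KW) :
    (matZ1 ts o *ᵥ v) (Sum.inl (Sum.inl (t, k))) =
      (1 - trtD o) * covZ o k * v (Sum.inl (Sum.inl t)) := by
  simp [matZ1, matZ, matZA, mulVec, dotProduct, Fintype.sum_sum_type]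

lemma mulVec_matZ1_pre (ts : ℕ) (o : Obs T KX KW) (v : QIdx1 T ts KX → ℝ) (t : Pre ts)
    (k : ZIdx KX KW) :
    (matZ1 ts o *ᵥ v) (Sum.inl (Sum.inr (t, k))) =
      trtD o * covZ o k * v (Sum.inl (Sum.inr t)) := by
  simp [matZ1, matZ, matZB, mulVec, dotProduct, Fintype.sum_sum_type]

lemma mulVec_matZ1_aux (ts : ℕ) (o : Obs T KX KW) (v : QIdx1 T ts KX → ℝ) (a : AuxIdx T KX) :
    (matZ1 ts o *ᵥ v) (Sum.inr a) = v (Sum.inr a) := by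
  simp [matZ1, mulVec, dotProduct, Fintype.sum_sum_type, Matrix.one_apply]

lemma resid_late (ts : ℕ) (γ : LIdx1 T KX → ℝ) (o : Obs T KX KW) (t : Late T) :
    resid ts γ o (Sum.inl (Sum.inl t)) =
      outY o t - outY o 1 - (covX o ⬝ᵥ parBeta γ t + (outY o 2 - outY o 1) * parF γ t) := by
  simp [resid, vecY1, vecY, matX1, matX, matXA, mulVec, dotProduct, Fintype.sum_sum_type,
    Fintype.sum_prod_type, rowX, parBeta, parF, Finset.sum_ite_eq]

/-- The index t is the copy in 3, …, T of the pre-treatment period s; it selects the block of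
coefficients belonging to that period. -/
lemma resid_pre (ts : ℕ) (γ : LIdx1 T KX → ℝ) (o : Obs T KX KW) (s : Pre ts) (t : Late T)
    (hst : (s : ℕ) = t) :
    resid ts γ o (Sum.inl (Sum.inr s)) =
      outY o t - outY o 1 - (covX o ⬝ᵥ parBeta γ t + (outY o 2 - outY o 1) * parF γ t) := by
  simp [resid, vecY1, vecY, matX1, matX, matXB, mulVec, dotProduct, Fintype.sum_sum_type,
    Fintype.sum_prod_type, rowX, parBeta, parF, Finset.sum_ite_eq, hst]

lemma resid_aux (ts : ℕ) (γ : LIdx1 T KX → ℝ) (o : Obs T KX KW) (a : AuxIdx T KX) :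
    resid ts γ o (Sum.inr a) = vecAux o a - γ (Sum.inr a) := by
  simp [resid, vecY1, matX1, mulVec, dotProduct, Fintype.sum_sum_type, Matrix.one_apply]

lemma measurable_matZ1 (ts : ℕ) (r : MIdx1 T ts KX KW) (c : QIdx1 T ts KX) :
    Measurable fun o : Obs T KX KW => matZ1 ts o r c := by
  have hZ : ∀ k, Measurable fun o : Obs T KX KW => covZ o k :=
    fun k => (measurable_pi_apply k).comp measurable_covZ
  have hD : Measurable fun o : Obs T KX KW => trtD o := measurable_trtD
  rcases r with (⟨t, k⟩ | ⟨t, k⟩) | a <;> rcases c with (s | s) | b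
  · simp only [matZ1, matZ, matZA, fromBlocks_apply₁₁, of_apply]
    split_ifs
    exacts [(measurable_const.sub hD).mul (hZ k), measurable_const]
  · exact measurable_const
  · exact measurable_const
  · exact measurable_const
  · simp only [matZ1, matZ, matZB, fromBlocks_apply₁₁, fromBlocks_apply₂₂, of_apply]
    split_ifs
    exacts [hD.mul (hZ k), measurable_const]
  · exact measurable_const
  · exact measurable_const
  · exact measurable_const
  · exact measurable_const

lemma measurable_rowX (c : Fin KX ⊕ Unit) : Measurable fun o : Obs T KX KW => rowX o c := by
  rcases c with k | _
  · exact measurable_covX_apply k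
  · exact (measurable_outY 2).sub (measurable_outY 1)

lemma measurable_matX1 (ts : ℕ) (r : QIdx1 T ts KX) (c : LIdx1 T KX) :
    Measurable fun o : Obs T KX KW => matX1 ts o r c := by
  rcases r with (t | t) | a <;> rcases c with ⟨u, c⟩ | b
  · simp only [matX1, matX, matXA, fromBlocks_apply₁₁, fromRows_apply_inl, of_apply]
    split_ifs
    exacts [measurable_rowX c, measurable_const]
  · exact measurable_const
  · simp only [matX1, matX, matXB, fromBlocks_apply₁₁, fromRows_apply_inr, of_apply]
    split_ifs
    exacts [measurable_rowX c, measurable_const]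
  · exact measurable_const
  · exact measurable_const
  · exact measurable_const

lemma measurable_vecAux (a : AuxIdx T KX) : Measurable fun o : Obs T KX KW => vecAux o a := by
  rcases a with k | t | _
  · exact measurable_trtD.mul (measurable_covX_apply k)
  · exact measurable_trtD.mul (measurable_outY t)
  · exact measurable_trtD

lemma measurable_vecY1 (ts : ℕ) (c : QIdx1 T ts KX) :
    Measurable fun o : Obs T KX KW => vecY1 ts o c := by
  rcases c with (t | t) | a
  · exact (measurable_outY t).sub (measurable_outY 1)
  · exact (measurable_outY t).sub (measurable_outY 1)
  · exact measurable_vecAux a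

lemma measurable_obsG (ts : ℕ) (r : MIdx1 T ts KX KW) (c : LIdx1 T KX) :
    Measurable fun o : Obs T KX KW => obsG ts o r c := by
  simp only [obsG, mul_apply]
  exact Finset.measurable_fun_sum _ fun j _ => (measurable_matZ1 ts r j).mul
    (measurable_matX1 ts j c)

lemma measurable_obsH (ts : ℕ) (r : MIdx1 T ts KX KW) :
    Measurable fun o : Obs T KX KW => obsH ts o r := by
  simp only [obsH, mulVec, dotProduct]
  exact Finset.measurable_fun_sum _ fun j _ => (measurable_matZ1 ts r j).mul
    (measurable_vecY1 ts j)

/-! ### Population moments -/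

section Population

variable {Ω : Type*} [MeasurableSpace Ω] {μ : Measure Ω} [IsProbabilityMeasure μ]
  {O : Ω → Obs T KX KW} {ts : ℕ}

lemma integrable_obsG
    (hint : ∀ r c, Integrable (fun ω => (matZ ts (O ω) * matX ts (O ω)) r c) μ) (r c) :
    Integrable (fun ω => obsG ts (O ω) r c) μ := by
  simp only [obsG_eq]
  rcases r with r | r <;> rcases c with c | c
  · exact hint r c
  · exact integrable_const _
  · exact integrable_const _
  · exact integrable_const _

lemma popM_eq : popM μ O ts = fromBlocks (popZX μ O ts) 0 0 1 := by
  ext r c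
  have : popM μ O ts r c = ∫ ω, obsG ts (O ω) r c ∂μ := rfl
  rw [this]
  simp only [obsG_eq]
  rcases r with r | r <;> rcases c with c | c
  · rfl
  · simp
  · simp
  · simp

lemma mulVec_injective_of_rank_eq {m n : Type*} [Fintype m] [Fintype n] {A : Matrix m n ℝ}
    (h : A.rank = Fintype.card n) : Function.Injective A.mulVec := by
  classical
  have h1 := A.mulVecLin.finrank_range_add_finrank_ker
  rw [← Matrix.rank, h, Module.finrank_fintype_fun_eq_card] at h1
  have h2 : Module.finrank ℝ (LinearMap.ker A.mulVecLin) = 0 := by omega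
  have h3 : LinearMap.ker A.mulVecLin = ⊥ := Submodule.finrank_eq_zero.1 h2
  exact LinearMap.ker_eq_bot.1 h3

/-- The augmentation adds an identity block on the diagonal, so full column rank is inherited from
the relevance condition. -/
lemma popM_injective (h : (popZX μ O ts).rank = Fintype.card (LIdx T KX)) :
    Function.Injective (popM μ O ts).mulVec := by
  have hinj := mulVec_injective_of_rank_eq h
  intro v w hvw
  rw [popM_eq, ← Sum.elim_comp_inl_inr v, ← Sum.elim_comp_inl_inr w, fromBlocks_mulVec,
    fromBlocks_mulVec] at hvw
  simp only [zero_mulVec, add_zero, zero_add, one_mulVec, Sum.elim_comp_inl,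
    Sum.elim_comp_inr] at hvw
  have h1 : v ∘ Sum.inl = w ∘ Sum.inl := hinj (funext fun r => congrFun hvw (Sum.inl r))
  have h2 : v ∘ Sum.inr = w ∘ Sum.inr := funext fun r => congrFun hvw (Sum.inr r)
  rw [← Sum.elim_comp_inl_inr v, ← Sum.elim_comp_inl_inr w, h1, h2]

lemma popOmega_apply (γ : LIdx1 T KX → ℝ) (r s : MIdx1 T ts KX KW) :
    popOmega μ O ts γ r s = ∫ ω, (obsH ts (O ω) - obsG ts (O ω) *ᵥ γ) r *
      (obsH ts (O ω) - obsG ts (O ω) *ᵥ γ) s ∂μ := by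
  simp only [popOmega, momOuter_eq, of_apply, vecMulVec_apply]

/-- Positive diagonal entries of `Ω` are integrals of squares that exist, so the moment
functions are square integrable. -/
lemma memLp_moment (hO : Measurable O) {γ : LIdx1 T KX → ℝ} (hΩ : (popOmega μ O ts γ).PosDef)
    (r : MIdx1 T ts KX KW) :
    MemLp (fun ω => (obsH ts (O ω) - obsG ts (O ω) *ᵥ γ) r) 2 μ := by
  have hm : Measurable fun ω => (obsH ts (O ω) - obsG ts (O ω) *ᵥ γ) r :=
    (MomentModel.measurable_moment (measurable_obsG ts) (measurable_obsH ts) r).comp hO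
  refine (memLp_two_iff_integrable_sq hm.aestronglyMeasurable).2 ?_
  have hpos := hΩ.diag_pos (i := r)
  by_contra hni
  rw [popOmega_apply] at hpos
  simp only [← sq] at hpos
  -- The integral of a non-integrable function is 0 by convention, which contradicts the positive
  -- diagonal entry.
  rw [integral_undef hni] at hpos
  exact lt_irrefl _ hpos

lemma moment_aux (γ : LIdx1 T KX → ℝ) (o : Obs T KX KW) (a : AuxIdx T KX) :
    (obsH ts o - obsG ts o *ᵥ γ) (Sum.inr a) = vecAux o a - γ (Sum.inr a) := by
  rw [obsH_sub, mulVec_matZ1_aux, resid_aux]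

lemma integrable_vecAux (hO : Measurable O) {γ : LIdx1 T KX → ℝ}
    (hΩ : (popOmega μ O ts γ).PosDef) (a : AuxIdx T KX) :
    Integrable (fun ω => vecAux (O ω) a) μ := by
  have h1 := ((memLp_moment hO hΩ (Sum.inr a)).integrable one_le_two).add
    (integrable_const (γ (Sum.inr a)))
  refine h1.congr (ae_of_all _ fun ω => ?_)
  simp only [Pi.add_apply, moment_aux]
  ring

lemma integral_trtD_mul (hO : Measurable O) (f : Ω → ℝ) :
    ∫ ω, trtD (O ω) * f ω ∂μ = ∫ ω in evD O true, f ω ∂μ := by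
  rw [← integral_indicator (measurableSet_evD hO true)]
  refine integral_congr_ae (ae_of_all _ fun ω => ?_)
  by_cases h : treated (O ω) = true <;> simp [trtD, evD, h]

lemma parP_popParam (hO : Measurable O) (β : ℕ → Fin KX → ℝ) (F : ℕ → ℝ) :
    parP (popParam μ O β F) = μ.real (evD O true) := by
  have h := integral_trtD_mul (μ := μ) hO (fun _ => 1)
  simp only [mul_one, integral_const, smul_eq_mul, measureReal_restrict_apply_univ] at h
  exact h

/-- If D = 0 almost surely, then p = 0 and the last moment function D - p vanishes, so Ω would have
a zero diagonal entry. -/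
lemma measure_treated_ne_zero (hO : Measurable O) {β : ℕ → Fin KX → ℝ} {F : ℕ → ℝ}
    (hΩ : (popOmega μ O ts (popParam μ O β F)).PosDef) : μ (evD O true) ≠ 0 := by
  intro h0
  have hpos := hΩ.diag_pos (i := Sum.inr (Sum.inr (Sum.inr ())))
  rw [popOmega_apply] at hpos
  simp only [moment_aux] at hpos
  have hp : popParam μ O β F (Sum.inr (Sum.inr (Sum.inr ()))) = 0 := by
    have := parP_popParam (μ := μ) hO β F
    rw [measureReal_def, h0] at this
    exact this
  rw [integral_eq_zero_of_ae] at hpos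
  · exact lt_irrefl _ hpos
  · have : ∀ᵐ ω ∂μ, ω ∉ evD O true := measure_eq_zero_iff_ae_notMem.1 h0
    filter_upwards [this] with ω hω
    have hD : trtD (O ω) = 0 := if_neg hω
    simp [vecAux, hD, hp]

end Population

/-! ### The interactive fixed effects model -/

section Model

variable {ts : ℕ} {Ω : Type*} [MeasurableSpace Ω] {μ : Measure Ω}
  {O : Ω → Obs T KX KW} {Yone Yzero U : ℕ → Ω → ℝ} {ξ lam : Ω → ℝ}
  {β : ℕ → Fin KX → ℝ} {α : Fin KW → ℝ} {F : ℕ → ℝ}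

/-- Potential outcomes with interactive fixed effects and selection on `(ξ, λ, Z)`. -/
structure Model (ts : ℕ) (μ : Measure Ω) (O : Ω → Obs T KX KW) (Yone Yzero U : ℕ → Ω → ℝ)
    (ξ lam : Ω → ℝ) (β : ℕ → Fin KX → ℝ) (α : Fin KW → ℝ) (F : ℕ → ℝ) : Prop where
  three_le : 3 ≤ ts
  le_T : ts ≤ T
  measO : Measurable O
  measξ : Measurable ξ
  measlam : Measurable lam
  obs_pre : ∀ t ∈ Finset.Icc 1 T, t < ts → ∀ᵐ ω ∂μ, outY (O ω) t = Yzero t ω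
  obs_post : ∀ t ∈ Finset.Icc 1 T, ts ≤ t → ∀ᵐ ω ∂μ, outY (O ω) t =
    trtD (O ω) * Yone t ω + (1 - trtD (O ω)) * Yzero t ω
  pre : ∀ t ∈ Finset.Icc 1 T, t < ts → ∀ᵐ ω ∂μ, treated (O ω) = true → Yone t ω = Yzero t ω
  F1 : F 1 = 0
  F2 : F 2 = 1
  β1 : β 1 = 0
  β2 : β 2 = 0
  model : ∀ t ∈ Finset.Icc 1 T, ∀ᵐ ω ∂μ,
    Yzero t ω = ξ ω + lam ω * F t + covX (O ω) ⬝ᵥ β t + covW (O ω) ⬝ᵥ α + U t ω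
  U_int : ∀ t ∈ Finset.Icc 1 T, Integrable (U t) μ
  U_mean : ∀ t ∈ Finset.Icc 1 T, μ[U t | condSigma O ξ lam] =ᵐ[μ] 0
  Y0_int : ∀ t ∈ Finset.Icc 1 T, Integrable (Yzero t) μ
  sel : ∀ t ∈ Finset.Icc 1 T, SameCondMean μ O ξ lam (Yzero t)

/-- The error of the equation from which `ξ` and `λ` have been eliminated. -/
def quasiError (U : ℕ → Ω → ℝ) (F : ℕ → ℝ) (t : ℕ) (ω : Ω) : ℝ :=
  U t ω - U 1 ω - F t * (U 2 ω - U 1 ω)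

namespace Model

lemma one_mem (H : Model ts μ O Yone Yzero U ξ lam β α F) : 1 ∈ Finset.Icc 1 T :=
  Finset.mem_Icc.2 ⟨le_rfl, by have := H.three_le; have := H.le_T; omega⟩

lemma two_mem (H : Model ts μ O Yone Yzero U ξ lam β α F) : 2 ∈ Finset.Icc 1 T :=
  Finset.mem_Icc.2 ⟨by norm_num, by have := H.three_le; have := H.le_T; omega⟩

/-- Since `3 ≤ ts`, the observed outcomes of periods 1 and 2 are untreated for everybody. They
determine ξ + W'α and λ up to errors; W'α drops out together with ξ because α does not vary over
time. -/
lemma quasi_difference (H : Model ts μ O Yone Yzero U ξ lam β α F) {t : ℕ}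
    (ht : t ∈ Finset.Icc 1 T) :
    ∀ᵐ ω ∂μ, Yzero t ω = outY (O ω) 1 + F t * (outY (O ω) 2 - outY (O ω) 1) +
      covX (O ω) ⬝ᵥ β t + quasiError U F t ω := by
  have h3 := H.three_le
  filter_upwards [H.model t ht, H.model 1 H.one_mem, H.model 2 H.two_mem,
    H.obs_pre 1 H.one_mem (by omega), H.obs_pre 2 H.two_mem (by omega)] with ω h h1 h2 h1' h2'
  rw [h1', h2', h, h1, h2, H.F1, H.F2, H.β1, H.β2, quasiError]
  simp only [dotProduct_zero]
  ring

lemma quasi_difference_untreated (H : Model ts μ O Yone Yzero U ξ lam β α F) {t : ℕ}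
    (ht : t ∈ Finset.Icc 1 T) :
    ∀ᵐ ω ∂μ, ω ∈ evD O false → outY (O ω) t - outY (O ω) 1 -
      (covX (O ω) ⬝ᵥ β t + (outY (O ω) 2 - outY (O ω) 1) * F t) = quasiError U F t ω := by
  have hY : ∀ᵐ ω ∂μ, ω ∈ evD O false → outY (O ω) t = Yzero t ω := by
    rcases lt_or_ge t ts with h | h
    · filter_upwards [H.obs_pre t ht h] with ω hω _
      exact hω
    · filter_upwards [H.obs_post t ht h] with ω hω hd
      have hd' : treated (O ω) = false := hd
      have hD : trtD (O ω) = 0 := by simp [trtD, hd']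
      rw [hω, hD]
      ring
  filter_upwards [H.quasi_difference ht, hY] with ω h1 h2 hd
  rw [h2 hd, h1]
  ring

lemma quasi_difference_pre (H : Model ts μ O Yone Yzero U ξ lam β α F) {t : ℕ}
    (ht : t ∈ Finset.Icc 1 T) (htt : t < ts) :
    ∀ᵐ ω ∂μ, outY (O ω) t - outY (O ω) 1 -
      (covX (O ω) ⬝ᵥ β t + (outY (O ω) 2 - outY (O ω) 1) * F t) = quasiError U F t ω := by
  filter_upwards [H.quasi_difference ht, H.obs_pre t ht htt] with ω h1 h2
  rw [h2, h1]
  ring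

lemma integrable_quasiError (H : Model ts μ O Yone Yzero U ξ lam β α F) {t : ℕ}
    (ht : t ∈ Finset.Icc 1 T) : Integrable (quasiError U F t) μ :=
  ((H.U_int t ht).sub (H.U_int 1 H.one_mem)).sub
    (((H.U_int 2 H.two_mem).sub (H.U_int 1 H.one_mem)).const_mul _)

variable [IsProbabilityMeasure μ]

lemma setIntegral_U (H : Model ts μ O Yone Yzero U ξ lam β α F) {t : ℕ}
    (ht : t ∈ Finset.Icc 1 T) {A : Set Ω} (hA : MeasurableSet[condSigma O ξ lam] A) (d : Bool) :
    ∫ ω in A ∩ evD O d, U t ω ∂μ = 0 := by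
  -- The part of Y_t(0) that is a function of (ξ, λ, Z).
  let k : ℝ × ℝ × (ZIdx KX KW → ℝ) → ℝ := fun x => x.1 + x.2.1 * F t +
    (∑ i, x.2.2 (Sum.inl i) * β t i) + ∑ i, x.2.2 (Sum.inr i) * α i
  have hk : Measurable k := by fun_prop
  exact (H.sel t ht).setIntegral_error H.measO H.measξ H.measlam (H.Y0_int t ht) (H.U_int t ht)
    (H.U_mean t ht) hk (H.model t ht) hA d

lemma setIntegral_quasiError (H : Model ts μ O Yone Yzero U ξ lam β α F) {t : ℕ}
    (ht : t ∈ Finset.Icc 1 T) {A : Set Ω} (hA : MeasurableSet[condSigma O ξ lam] A) (d : Bool) :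
    ∫ ω in A ∩ evD O d, quasiError U F t ω ∂μ = 0 := by
  have h0 := (H.U_int t ht).integrableOn (s := A ∩ evD O d)
  have h1 := (H.U_int 1 H.one_mem).integrableOn (s := A ∩ evD O d)
  have h2 := (H.U_int 2 H.two_mem).integrableOn (s := A ∩ evD O d)
  have h3 : IntegrableOn (fun ω => U t ω - U 1 ω) (A ∩ evD O d) μ := h0.sub h1
  have h4 : IntegrableOn (fun ω => F t * (U 2 ω - U 1 ω)) (A ∩ evD O d) μ :=
    (h2.sub h1).const_mul _
  simp only [quasiError]
  rw [integral_sub h3 h4, integral_sub h0 h1, integral_const_mul, integral_sub h2 h1,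
    H.setIntegral_U ht hA, H.setIntegral_U H.one_mem hA,
    H.setIntegral_U H.two_mem hA]
  ring

/-- Z is unbounded, so orthogonality to the error needs integrability of the product. It comes from
m, the observed moment function, which agrees with that product almost everywhere. -/
lemma integral_moment_eq_zero (H : Model ts μ O Yone Yzero U ξ lam β α F) {t : ℕ}
    (ht : t ∈ Finset.Icc 1 T) (d : Bool) (k : ZIdx KX KW) {m : Ω → ℝ} (hm : Integrable m μ)
    (hmk : ∀ᵐ ω ∂μ, m ω = covZ (O ω) k * (evD O d).indicator (quasiError U F t) ω) :
    ∫ ω, m ω ∂μ = 0 := by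
  rw [integral_congr_ae hmk]
  have hk : Measurable fun x : ℝ × ℝ × (ZIdx KX KW → ℝ) => x.2.2 k := by fun_prop
  exact integral_mul_indicator_eq_zero (k := fun x => x.2.2 k) H.measO H.measξ H.measlam
    (H.integrable_quasiError ht) (fun A hA => H.setIntegral_quasiError ht hA d) hk (hm.congr hmk)

lemma parBeta_popParam (t : Late T) : parBeta (popParam μ O β F) t = β t := rfl

lemma parF_popParam (t : Late T) : parF (popParam μ O β F) t = F t := rfl

/-- The moment conditions hold at the true parameter. -/
lemma mean_zero (H : Model ts μ O Yone Yzero U ξ lam β α F)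
    (hΩ : (popOmega μ O ts (popParam μ O β F)).PosDef) (r : MIdx1 T ts KX KW) :
    ∫ ω, (obsH ts (O ω) - obsG ts (O ω) *ᵥ popParam μ O β F) r ∂μ = 0 := by
  have hint := (memLp_moment H.measO hΩ r).integrable one_le_two
  rcases r with (⟨t, k⟩ | ⟨t, k⟩) | a
  · have ht : (t : ℕ) ∈ Finset.Icc 1 T := Finset.Icc_subset_Icc_left (by norm_num) t.2
    refine H.integral_moment_eq_zero ht false k hint ?_
    filter_upwards [H.quasi_difference_untreated ht] with ω hω
    rw [obsH_sub, mulVec_matZ1_late, resid_late, parBeta_popParam, parF_popParam]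
    by_cases hd : ω ∈ evD O false
    · have hd' : treated (O ω) = false := hd
      rw [hω hd, Set.indicator_of_mem hd]
      simp [trtD, hd']
    · have hd' : treated (O ω) = true := by simpa [evD] using hd
      rw [Set.indicator_of_notMem hd]
      simp [trtD, hd']
  · have h2 := Finset.mem_Ico.1 t.2
    have hle := H.le_T
    have ht3 : (t : ℕ) ∈ Finset.Icc 3 T := Finset.mem_Icc.2 ⟨h2.1, by omega⟩
    have ht : (t : ℕ) ∈ Finset.Icc 1 T := Finset.Icc_subset_Icc_left (by norm_num) ht3
    refine H.integral_moment_eq_zero ht true k hint ?_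
    filter_upwards [H.quasi_difference_pre ht h2.2] with ω hω
    rw [obsH_sub, mulVec_matZ1_pre, resid_pre ts _ _ t ⟨t, ht3⟩ rfl, parBeta_popParam,
      parF_popParam, hω]
    by_cases hd : ω ∈ evD O true
    · have hd' : treated (O ω) = true := hd
      rw [Set.indicator_of_mem hd]
      simp [trtD, hd']
    · have hd' : treated (O ω) = false := by simpa [evD] using hd
      rw [Set.indicator_of_notMem hd]
      simp [trtD, hd']
  · simp only [moment_aux]
    rw [integral_sub (integrable_vecAux H.measO hΩ a) (integrable_const _)]
    simp [popParam]

lemma momentModel (H : Model ts μ O Yone Yzero U ξ lam β α F)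
    (hZX_int : ∀ r c, Integrable (fun ω => (matZ ts (O ω) * matX ts (O ω)) r c) μ)
    (hrel : (popZX μ O ts).rank = Fintype.card (LIdx T KX))
    (hΩ : (popOmega μ O ts (popParam μ O β F)).PosDef)
    {Ω' : Type*} [MeasurableSpace Ω'] {ν : Measure Ω'} {S : ℕ → Ω' → Obs T KX KW}
    (hS_indep : iIndepFun S ν) (hS_law : ∀ i, IdentDistrib (S i) O ν μ) :
    MomentModel μ O ν S (obsG ts) (obsH ts) (popParam μ O β F) (popM μ O ts)
      (popOmega μ O ts (popParam μ O β F)) where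
  indep := hS_indep
  law := hS_law
  measG := measurable_obsG ts
  measH := measurable_obsH ts
  intG := integrable_obsG hZX_int
  meanG := fun _ _ => rfl
  memLp := memLp_moment H.measO hΩ
  mean_zero := H.mean_zero hΩ
  cov := fun r s => (popOmega_apply _ r s).symm
  injM := popM_injective hrel
  posOm := hΩ

/-! ### Identification of the treatment effects -/

lemma parDY_popParam {s : ℕ} (hs : s ∈ Finset.Icc 1 T) :
    parDY (popParam μ O β F) s = ∫ ω, trtD (O ω) * outY (O ω) s ∂μ := by
  rw [parDY, dif_pos hs]
  rfl

/-- For a treated unit the observed outcome equals Y_t(1), before treatment because the potential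
outcomes coincide there. Only Y_t(0) is missing, and `quasi_difference` supplies it. -/
lemma ae_trtD_mul_effect (H : Model ts μ O Yone Yzero U ξ lam β α F) {t : ℕ}
    (ht : t ∈ Finset.Icc 1 T) : ∀ᵐ ω ∂μ, trtD (O ω) * (Yone t ω - Yzero t ω) =
      trtD (O ω) * outY (O ω) t - (trtD (O ω) * outY (O ω) 1 + F t * (trtD (O ω) * outY (O ω) 2 -
        trtD (O ω) * outY (O ω) 1) + ∑ k, trtD (O ω) * covX (O ω) k * β t k) -
        trtD (O ω) * quasiError U F t ω := by
  have hY : ∀ᵐ ω ∂μ, trtD (O ω) * (Yone t ω - Yzero t ω) =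
      trtD (O ω) * (outY (O ω) t - Yzero t ω) := by
    rcases lt_or_ge t ts with h | h
    · filter_upwards [H.obs_pre t ht h, H.pre t ht h] with ω h1 h2
      by_cases hd : treated (O ω) = true
      · rw [h1, h2 hd]
      · simp [trtD, hd]
    · filter_upwards [H.obs_post t ht h] with ω h1
      by_cases hd : treated (O ω) = true
      · simp [h1, trtD, hd]
      · simp [trtD, hd]
  filter_upwards [hY, H.quasi_difference ht] with ω h1 h2
  rw [h1, h2]
  simp only [mul_assoc, ← Finset.mul_sum]
  simp only [dotProduct]
  ring

lemma integrable_trtD_mul_outY (H : Model ts μ O Yone Yzero U ξ lam β α F)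
    (hΩ : (popOmega μ O ts (popParam μ O β F)).PosDef) {s : ℕ} (hs : s ∈ Finset.Icc 1 T) :
    Integrable (fun ω => trtD (O ω) * outY (O ω) s) μ :=
  integrable_vecAux H.measO hΩ (Sum.inr (Sum.inl ⟨s, hs⟩))

lemma integrable_trtD_mul_covX (H : Model ts μ O Yone Yzero U ξ lam β α F)
    (hΩ : (popOmega μ O ts (popParam μ O β F)).PosDef) (k : Fin KX) :
    Integrable (fun ω => trtD (O ω) * covX (O ω) k) μ :=
  integrable_vecAux H.measO hΩ (Sum.inl k)

lemma trtD_mul_eq_indicator (f : Ω → ℝ) :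
    (fun ω => trtD (O ω) * f ω) = (evD O true).indicator f := by
  ext ω
  by_cases h : treated (O ω) = true <;> simp [trtD, evD, h]

lemma integrable_trtD_mul_quasiError (H : Model ts μ O Yone Yzero U ξ lam β α F) {t : ℕ}
    (ht : t ∈ Finset.Icc 1 T) : Integrable (fun ω => trtD (O ω) * quasiError U F t ω) μ := by
  rw [trtD_mul_eq_indicator]
  exact (H.integrable_quasiError ht).indicator (measurableSet_evD H.measO true)

/-- Integrability of Y_t(1) is not assumed; it is replaced by that of D Y_t, D X and the error, the
first two coming from the positive definite Ω. -/
lemma integrable_trtD_mul_effect (H : Model ts μ O Yone Yzero U ξ lam β α F)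
    (hΩ : (popOmega μ O ts (popParam μ O β F)).PosDef) {t : ℕ} (ht : t ∈ Finset.Icc 1 T) :
    Integrable (fun ω => trtD (O ω) * (Yone t ω - Yzero t ω)) μ := by
  have hY := fun {s} hs => H.integrable_trtD_mul_outY hΩ (s := s) hs
  refine Integrable.congr ?_ ((H.ae_trtD_mul_effect ht).mono fun ω hω => hω.symm)
  exact ((hY ht).sub (((hY H.one_mem).add (((hY H.two_mem).sub (hY H.one_mem)).const_mul _)).add
    (integrable_finsetSum _ fun k _ => (H.integrable_trtD_mul_covX hΩ k).mul_const _))).sub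
    (H.integrable_trtD_mul_quasiError ht)

lemma integrable_effect (H : Model ts μ O Yone Yzero U ξ lam β α F)
    (hΩ : (popOmega μ O ts (popParam μ O β F)).PosDef) {t : ℕ} (ht : t ∈ Finset.Icc 1 T) :
    Integrable (fun ω => Yone t ω - Yzero t ω) (ProbabilityTheory.cond μ (evD O true)) := by
  have h := H.integrable_trtD_mul_effect hΩ ht
  rw [trtD_mul_eq_indicator, integrable_indicator_iff (measurableSet_evD H.measO true)] at h
  exact Integrable.smul_measure h
    (ENNReal.inv_ne_top.2 (measure_treated_ne_zero H.measO hΩ))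

/-- Identification of the average treatment effects on the treated. -/
lemma popATT_eq (H : Model ts μ O Yone Yzero U ξ lam β α F)
    (hΩ : (popOmega μ O ts (popParam μ O β F)).PosDef) (t : Late T) :
    popATT μ O (Yone t) (Yzero t) = gATT t (popParam μ O β F) := by
  have ht : (t : ℕ) ∈ Finset.Icc 1 T := Finset.Icc_subset_Icc_left (by norm_num) t.2
  have hY := fun {s} hs => H.integrable_trtD_mul_outY hΩ (s := s) hs
  have hX := H.integrable_trtD_mul_covX hΩ
  -- The group-wise mean-zero property with A the whole space: the unobservable error averages out
  -- over the treated.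
  have hq : ∫ ω, trtD (O ω) * quasiError U F t ω ∂μ = 0 := by
    rw [integral_trtD_mul H.measO, ← Set.univ_inter (evD O true)]
    exact H.setIntegral_quasiError ht MeasurableSet.univ true
  have hmain : ∫ ω in evD O true, (Yone t ω - Yzero t ω) ∂μ =
      parDY (popParam μ O β F) t - (parDY (popParam μ O β F) 1 + F t *
        (parDY (popParam μ O β F) 2 - parDY (popParam μ O β F) 1) +
        ∑ k, parDX (popParam μ O β F) k * β t k) := by
    rw [← integral_trtD_mul H.measO, integral_congr_ae (H.ae_trtD_mul_effect ht),
      parDY_popParam ht, parDY_popParam H.one_mem, parDY_popParam H.two_mem]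
    have hs : Integrable (fun ω => ∑ k, trtD (O ω) * covX (O ω) k * β t k) μ :=
      integrable_finsetSum _ fun k _ => (hX k).mul_const _
    have hd : Integrable (fun ω => F t * (trtD (O ω) * outY (O ω) 2 -
        trtD (O ω) * outY (O ω) 1)) μ := ((hY H.two_mem).sub (hY H.one_mem)).const_mul _
    have ha : Integrable (fun ω => trtD (O ω) * outY (O ω) 1 + F t * (trtD (O ω) * outY (O ω) 2 -
        trtD (O ω) * outY (O ω) 1)) μ := (hY H.one_mem).add hd
    have hb : Integrable (fun ω => trtD (O ω) * outY (O ω) 1 + F t * (trtD (O ω) * outY (O ω) 2 -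
        trtD (O ω) * outY (O ω) 1) + ∑ k, trtD (O ω) * covX (O ω) k * β t k) μ := ha.add hs
    have hc : Integrable (fun ω => trtD (O ω) * outY (O ω) t - (trtD (O ω) * outY (O ω) 1 +
        F t * (trtD (O ω) * outY (O ω) 2 - trtD (O ω) * outY (O ω) 1) +
        ∑ k, trtD (O ω) * covX (O ω) k * β t k)) μ := (hY ht).sub hb
    rw [integral_sub hc (H.integrable_trtD_mul_quasiError ht), hq, integral_sub (hY ht) hb,
      integral_add ha hs, integral_add (hY H.one_mem) hd, integral_const_mul,
      integral_sub (hY H.two_mem) (hY H.one_mem),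
      integral_finsetSum _ fun k _ => (hX k).mul_const _, sub_zero]
    simp only [integral_mul_const]
    rfl
  rw [popATT, ProbabilityTheory.cond, integral_smul_measure, hmain, gATT, parF_popParam,
    parBeta_popParam, parP_popParam H.measO, ENNReal.toReal_inv, ← measureReal_def, smul_eq_mul]
  have : ∀ k, parDX (popParam μ O β F) k / μ.real (evD O true) * β t k =
      (μ.real (evD O true))⁻¹ * (parDX (popParam μ O β F) k * β t k) := fun k => by ring
  simp only [this, ← Finset.mul_sum]
  ring

end Model

end Model

/-! ### The gradient of `g_t` -/

section Gradient

/-- Puts the directional derivative in the form in which it can be compared with the product and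
quotient rules. -/
lemma gradATT_dotProduct (t : Late T) (hT : 2 ≤ T) (γ v : LIdx1 T KX → ℝ) :
    gradATT t γ ⬝ᵥ v = (∑ k, -(parDX γ k / parP γ) * parBeta v t k) +
      -((parDY γ 2 - parDY γ 1) / parP γ) * parF v t +
      (∑ k, -(parBeta γ t k / parP γ) * parDX v k) +
      (-((1 - parF γ t) / parP γ) * parDY v 1 + -(parF γ t / parP γ) * parDY v 2 +
        1 / parP γ * parDY v t) + -(gATT t γ / parP γ) * parP v := by
  have ht3 : 3 ≤ (t : ℕ) := (Finset.mem_Icc.1 t.2).1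
  have ht : (t : ℕ) ∈ Finset.Icc 1 T := Finset.Icc_subset_Icc_left (by norm_num) t.2
  have h1 : 1 ∈ Finset.Icc 1 T := Finset.mem_Icc.2 ⟨le_rfl, by omega⟩
  have h2 : 2 ∈ Finset.Icc 1 T := Finset.mem_Icc.2 ⟨by norm_num, hT⟩
  have hper : ∀ s : Per T, (if (s : ℕ) = 1 then -((1 - parF γ t) / parP γ)
      else if (s : ℕ) = 2 then -(parF γ t / parP γ)
      else if (s : ℕ) = (t : ℕ) then 1 / parP γ else 0) * v (Sum.inr (Sum.inr (Sum.inl s))) =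
      (if s = ⟨1, h1⟩ then -((1 - parF γ t) / parP γ) * v (Sum.inr (Sum.inr (Sum.inl s))) else 0) +
      (if s = ⟨2, h2⟩ then -(parF γ t / parP γ) * v (Sum.inr (Sum.inr (Sum.inl s))) else 0) +
      (if s = ⟨t, ht⟩ then 1 / parP γ * v (Sum.inr (Sum.inr (Sum.inl s))) else 0) := by
    intro s
    simp only [Subtype.ext_iff]
    -- Since t ≥ 3, the periods 1, 2 and t are distinct, so at most one of the three indicators is
    -- active.
    split_ifs <;> first | omega | ring
  simp only [dotProduct, gradATT, Fintype.sum_sum_type, Fintype.sum_prod_type, Sum.elim_inl,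
    Sum.elim_inr, hper, Finset.sum_add_distrib, Finset.sum_ite_eq', Finset.mem_univ, if_true,
    ite_mul, zero_mul, Finset.univ_unique, Finset.sum_singleton, parBeta, parDX]
  rw [Finset.sum_comm]
  simp only [Finset.sum_ite_eq', Finset.mem_univ, if_true]
  simp only [parDY, dif_pos h1, dif_pos h2, dif_pos ht, parP, parF]
  ring

lemma measurable_gATT (t : Late T) : Measurable fun γ : LIdx1 T KX → ℝ => gATT t γ := by
  have hDY : ∀ s, Measurable fun γ : LIdx1 T KX → ℝ => parDY γ s := by
    intro s
    unfold parDY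
    split_ifs
    exacts [measurable_pi_apply _, measurable_const]
  have hP : Measurable fun γ : LIdx1 T KX → ℝ => parP γ := measurable_pi_apply _
  have hX : ∀ k, Measurable fun γ : LIdx1 T KX → ℝ => parDX γ k := fun k => measurable_pi_apply _
  have hB : ∀ k, Measurable fun γ : LIdx1 T KX → ℝ => parBeta γ t k :=
    fun k => measurable_pi_apply _
  have hF : Measurable fun γ : LIdx1 T KX → ℝ => parF γ t := measurable_pi_apply _
  exact (((hDY t).sub (hDY 1)).div hP).sub (Finset.measurable_fun_sum _ fun k _ =>
    ((hX k).div hP).mul (hB k)) |>.sub (hF.mul (((hDY 2).sub (hDY 1)).div hP))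

lemma hasGradientAt_gATT (t : Late T) (hT : 2 ≤ T) (γ : LIdx1 T KX → ℝ) (hp : parP γ ≠ 0) :
    HasGradientAt (fun v : EuclideanSpace ℝ (LIdx1 T KX) => gATT t v.ofLp)
      (WithLp.toLp 2 (gradATT t γ)) (WithLp.toLp 2 γ) := by
  let π : LIdx1 T KX → EuclideanSpace ℝ (LIdx1 T KX) →L[ℝ] ℝ := fun i => EuclideanSpace.proj i
  have hco : ∀ i, HasFDerivAt (fun v : EuclideanSpace ℝ (LIdx1 T KX) => v.ofLp i)
      (π i) (WithLp.toLp 2 γ) := fun i => (π i).hasFDerivAt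
  have hπ : ∀ i v, π i v = v.ofLp i := fun _ _ => rfl
  have hDY : ∀ s, ∃ L : EuclideanSpace ℝ (LIdx1 T KX) →L[ℝ] ℝ,
      HasFDerivAt (fun v : EuclideanSpace ℝ (LIdx1 T KX) => parDY v.ofLp s) L (WithLp.toLp 2 γ) ∧
      ∀ v, L v = parDY v.ofLp s := by
    intro s
    unfold parDY
    split_ifs
    · exact ⟨_, hco _, fun v => rfl⟩
    · exact ⟨0, hasFDerivAt_const _ _, fun v => rfl⟩
  obtain ⟨L1, hL1, hL1v⟩ := hDY 1
  obtain ⟨L2, hL2, hL2v⟩ := hDY 2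
  obtain ⟨Lt, hLt, hLtv⟩ := hDY t
  have hP : HasFDerivAt (fun v : EuclideanSpace ℝ (LIdx1 T KX) => (parP v.ofLp)⁻¹)
      (-(parP γ ^ 2)⁻¹ • π (Sum.inr (Sum.inr (Sum.inr ())))) (WithLp.toLp 2 γ) :=
    (hasDerivAt_inv hp).comp_hasFDerivAt (WithLp.toLp 2 γ) (hco (Sum.inr (Sum.inr (Sum.inr ()))))
  have hX : ∀ k, HasFDerivAt (fun v : EuclideanSpace ℝ (LIdx1 T KX) => parDX v.ofLp k)
      (π (Sum.inr (Sum.inl k))) (WithLp.toLp 2 γ) := fun k => hco (Sum.inr (Sum.inl k))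
  have hB : ∀ k, HasFDerivAt (fun v : EuclideanSpace ℝ (LIdx1 T KX) => parBeta v.ofLp t k)
      (π (Sum.inl (t, Sum.inl k))) (WithLp.toLp 2 γ) := fun k => hco (Sum.inl (t, Sum.inl k))
  have hF : HasFDerivAt (fun v : EuclideanSpace ℝ (LIdx1 T KX) => parF v.ofLp t)
      (π (Sum.inl (t, Sum.inr ()))) (WithLp.toLp 2 γ) := hco (Sum.inl (t, Sum.inr ()))
  have hmain := (((hLt.fun_sub hL1).fun_mul hP).fun_sub (HasFDerivAt.fun_sum (u := Finset.univ)
    fun k _ => ((hX k).fun_mul hP).fun_mul (hB k))).fun_sub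
    (hF.fun_mul ((hL2.fun_sub hL1).fun_mul hP))
  simp only [← div_eq_mul_inv] at hmain
  rw [hasGradientAt_iff_hasFDerivAt]
  refine HasFDerivAt.congr_fderiv hmain ?_
  ext v
  have hin : inner ℝ (WithLp.toLp 2 (gradATT t γ)) v = gradATT t γ ⬝ᵥ v.ofLp := by
    simp [PiLp.inner_apply, dotProduct, mul_comm]
  rw [InnerProductSpace.toDual_apply_apply, hin, gradATT_dotProduct t hT, gATT]
  simp only [_root_.sub_apply, _root_.add_apply,
    _root_.smul_apply, _root_.sum_apply, smul_eq_mul, hπ, hL1v, hL2v,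
    hLtv, Finset.sum_add_distrib]
  simp only [parP, parDX, parBeta, parF]
  set p := γ (Sum.inr (Sum.inr (Sum.inr ()))) with hpdef
  set w := v.ofLp (Sum.inr (Sum.inr (Sum.inr ()))) with hw
  -- The derivative of the covariate term splits into its p-direction, which is part of the entry
  -- -g_t/p, and its E[DX]-direction, which gives the entries -β_t/p.
  have s1 : ∑ x, γ (Sum.inl (t, Sum.inl x)) * (γ (Sum.inr (Sum.inl x)) * (-(p ^ 2)⁻¹ * w) +
      p⁻¹ * v.ofLp (Sum.inr (Sum.inl x))) =
      -p⁻¹ * w * (∑ x, γ (Sum.inr (Sum.inl x)) / p * γ (Sum.inl (t, Sum.inl x))) -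
        ∑ x, -(γ (Sum.inl (t, Sum.inl x)) / p) * v.ofLp (Sum.inr (Sum.inl x)) := by
    rw [Finset.mul_sum, ← Finset.sum_sub_distrib]
    exact Finset.sum_congr rfl fun x _ => by ring
  rw [s1]
  simp only [neg_mul, Finset.sum_neg_distrib]
  ring

end Gradient

end IFE

end

/-! ### The main theorem. -/

theorem theorem3
    -- dimensions and timing
    (T ts KX KW : ℕ) (hT : 3 ≤ T) (hts : 3 ≤ ts) (htsT : ts ≤ T)
    -- population: observed data, potential outcomes, unobservables
    {Ω : Type*} [MeasurableSpace Ω] (μ : Measure Ω) [IsProbabilityMeasure μ]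
    (O : Ω → IFE.Obs T KX KW) (hO : Measurable O)
    (Yone Yzero U : ℕ → Ω → ℝ) (ξ lam : Ω → ℝ) (hξ : Measurable ξ) (hlam : Measurable lam)
    -- observed outcomes in terms of potential outcomes
    (hobs_pre : ∀ t ∈ Finset.Icc 1 T, t < ts → ∀ᵐ ω ∂μ, IFE.outY (O ω) t = Yzero t ω)
    (hobs_post : ∀ t ∈ Finset.Icc 1 T, ts ≤ t → ∀ᵐ ω ∂μ, IFE.outY (O ω) t =
      IFE.trtD (O ω) * Yone t ω + (1 - IFE.trtD (O ω)) * Yzero t ω)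
    (hpre : ∀ t ∈ Finset.Icc 1 T, t < ts → ∀ᵐ ω ∂μ,
      IFE.treated (O ω) = true → Yone t ω = Yzero t ω)
    -- interactive fixed effects model with its normalizations
    (β : ℕ → Fin KX → ℝ) (α : Fin KW → ℝ) (F : ℕ → ℝ)
    (hF1 : F 1 = 0) (hF2 : F 2 = 1) (hβ1 : β 1 = 0) (hβ2 : β 2 = 0)
    (hmodel : ∀ t ∈ Finset.Icc 1 T, ∀ᵐ ω ∂μ,
      Yzero t ω = ξ ω + lam ω * F t + IFE.covX (O ω) ⬝ᵥ β t + IFE.covW (O ω) ⬝ᵥ α + U t ω)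
    (hU_int : ∀ t ∈ Finset.Icc 1 T, Integrable (U t) μ)
    (hU : ∀ t ∈ Finset.Icc 1 T, μ[U t | IFE.condSigma O ξ lam] =ᵐ[μ] 0)
    -- selection on observables and time invariant unobservables
    (hY0_int : ∀ t ∈ Finset.Icc 1 T, Integrable (Yzero t) μ)
    (hsel : ∀ t ∈ Finset.Icc 1 T, IFE.SameCondMean μ O ξ lam (Yzero t))
    -- relevance
    (hZX_int : ∀ r c, Integrable
      (fun ω => (IFE.matZ ts (O ω) * IFE.matX ts (O ω)) r c) μ)
    (hrel : (IFE.popZX μ O ts).rank = Fintype.card (IFE.LIdx T KX))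
    -- fourth moments and positive definiteness
    (hY4 : Integrable (fun ω => (∑ r, IFE.vecY1 ts (O ω) r ^ 2) ^ 2) μ)
    (hZ4 : Integrable (fun ω => (∑ r, ∑ c, IFE.matZ1 ts (O ω) r c ^ 2) ^ 2) μ)
    (hΩ : (IFE.popOmega μ O ts (IFE.popParam μ O β F)).PosDef)
    -- the iid sample
    {Ω' : Type*} [MeasurableSpace Ω'] (ν : Measure Ω') [IsProbabilityMeasure ν]
    (S : ℕ → Ω' → IFE.Obs T KX KW) (hS_indep : iIndepFun S ν)
    (hS_law : ∀ i, IdentDistrib (S i) O ν μ)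
    -- first-step weighting matrices, possibly data dependent
    (A : ℕ → Ω' → Matrix (IFE.MIdx1 T ts KX KW) (IFE.MIdx1 T ts KX KW) ℝ)
    (hA_meas : ∀ n r c, AEMeasurable (fun ω => A n ω r c) ν)
    (A₀ : Matrix (IFE.MIdx1 T ts KX KW) (IFE.MIdx1 T ts KX KW) ℝ) (hA₀ : A₀.PosDef)
    (hA : ∀ r c, TendstoInMeasure ν (fun n ω => A n ω r c) atTop (fun _ => A₀ r c)) :
    let γ₁ : IFE.LIdx1 T KX → ℝ := IFE.popParam μ O β F
    let M := IFE.popM μ O ts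
    let Om := IFE.popOmega μ O ts γ₁
    let Sig : Matrix (IFE.LIdx1 T KX) (IFE.LIdx1 T KX) ℝ := (Mᵀ * Om⁻¹ * M)⁻¹
    let γhat : ℕ → Ω' → (IFE.LIdx1 T KX → ℝ) :=
      fun n ω => IFE.twoStep ts n (A n ω) (fun i => S i ω)
    (Mᵀ * Om⁻¹ * M).PosDef ∧
    TendstoInDistribution
      (fun (n : ℕ) ω => WithLp.toLp 2 (√(n : ℝ) • (γhat n ω - γ₁))) atTop
      (id : EuclideanSpace ℝ (IFE.LIdx1 T KX) → EuclideanSpace ℝ (IFE.LIdx1 T KX))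
      (fun _ => ν) (multivariateGaussian 0 Sig) ∧
    ∀ t : IFE.Late T,
      let ATT : ℝ := IFE.popATT μ O (Yone t) (Yzero t)
      let ATThat : ℕ → Ω' → ℝ := fun n ω => IFE.gATT t (γhat n ω)
      let grad : IFE.LIdx1 T KX → ℝ := IFE.gradATT t γ₁
      Integrable (fun ω => Yone t ω - Yzero t ω)
        (ProbabilityTheory.cond μ (IFE.evD O true)) ∧
      ATT = IFE.gATT t γ₁ ∧
      HasGradientAt (fun v : EuclideanSpace ℝ (IFE.LIdx1 T KX) => IFE.gATT t v.ofLp)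
        (WithLp.toLp 2 grad) (WithLp.toLp 2 γ₁) ∧
      TendstoInMeasure ν
        (fun (n : ℕ) ω => √(n : ℝ) * (ATThat n ω - ATT)
          - grad ⬝ᵥ (√(n : ℝ) • (γhat n ω - γ₁))) atTop (fun _ => 0) ∧
      TendstoInDistribution
        (fun (n : ℕ) ω => √(n : ℝ) * (ATThat n ω - ATT)) atTop (id : ℝ → ℝ)
        (fun _ => ν) (gaussianReal 0 (Real.toNNReal (grad ⬝ᵥ (Sig *ᵥ grad)))) := by
  intro γ₁ M Om Sig γhat
  have H : IFE.Model ts μ O Yone Yzero U ξ lam β α F :=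
    ⟨hts, htsT, hO, hξ, hlam, hobs_pre, hobs_post, hpre, hF1, hF2, hβ1, hβ2, hmodel, hU_int, hU,
      hY0_int, hsel⟩
  have HM := H.momentModel hZX_int hrel hΩ hS_indep hS_law
  have hpos : (Mᵀ * Om⁻¹ * M).PosDef := by
    have := HM.posOm.inv.conjTranspose_mul_mul_same HM.injM
    rwa [conjTranspose_eq_transpose_of_trivial] at this
  have hSig : Sig.PosSemidef := hpos.inv.posSemidef
  have hAT : Tendsto (fun q : ℕ × Ω' => A q.1 q.2) (IFE.probFilter ν) (𝓝 A₀) :=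
    IFE.tendsto_matrix_of_entries fun r c => 
      (IFE.tendsto_probFilter_iff (X := fun n ω => A n ω r c) (c := A₀ r c)).2 (hA r c)
  have hγ : ∀ n ω, γhat n ω =
      IFE.twoStepEst (IFE.obsG ts) (IFE.obsH ts) n (A n ω) (fun i => S i ω) :=
    fun n ω => IFE.twoStep_eq ts n (A n ω) _
  have hdist := HM.tendstoInDistribution_twoStepEst hA₀ hA_meas hAT
  simp only [← hγ] at hdist
  have hbdd : ∀ c, IFE.BddInProb ν fun q : ℕ × Ω' => √(q.1 : ℝ) * (γhat q.1 q.2 - γ₁) c := by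
    intro c
    simp only [hγ]
    exact HM.bddInProb_twoStepEst hA₀ hAT c
  have hmeas : ∀ n c, AEMeasurable (fun ω => γhat n ω c) ν := by
    intro n c
    simp only [hγ]
    exact HM.aemeasurable_twoStepEst hA_meas n c
  -- The map g_t divides by p, so differentiability at γ₁ needs a treated group of positive
  -- probability.
  have hp : IFE.parP γ₁ ≠ 0 := by
    rw [IFE.parP_popParam hO]
    exact (measureReal_ne_zero_iff).2 (IFE.measure_treated_ne_zero hO hΩ)
  refine ⟨hpos, hdist, fun t => ?_⟩
  have ht : (t : ℕ) ∈ Finset.Icc 1 T := Finset.Icc_subset_Icc_left (by norm_num) t.2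
  have hgrad := IFE.hasGradientAt_gATT t (by omega) γ₁ hp
  have hrem := IFE.tendsto_delta_remainder (g := fun q => γhat q.1 q.2) hbdd hgrad
  have hATT := H.popATT_eq hΩ t
  intro ATT ATThat grad
  refine ⟨H.integrable_effect hΩ ht, hATT, hgrad, ?_, ?_⟩
  · refine IFE.tendsto_probFilter_iff.1 ?_
    simp only [ATT, ATThat, hATT]
    exact hrem
  · have h := IFE.tendstoInDistribution_delta hSig (f := fun v => IFE.gATT t v.ofLp)
      (fun n => (IFE.measurable_gATT t).comp_aemeasurable (aemeasurable_pi_iff.2 (hmeas n)))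
      hdist hrem
    simp only [ATT, ATThat, hATT]
    exact h
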